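/- Let $\mathcal H$ be a real Hilbert space, $N\ge 1$, and let $\mathcal H^N$ carry the Hilbert product structure. Real $N\times N$ matrices $M$ act on $\mathcal H^N$ as $M\otimes I$. Let $G$ be a connected graph with vertex set $\{1,\dots,N\}$ and let $W=(w_{ij})\in\mathbb R^{N\times N}$ be a mixing matrix for $G$, i.e. $w_{ij}=0$ if $i\ne j$ and $ij$ is not an edge, $W=W^\top$, $\ker(I-W)=\mathbb R(1,\dots,1)^\top$, and $-I\prec W\preceq I$. For $i=1,\dots,N$ let $A_i:\mathcal H\rightrightarrows\mathcal H$ be maximally monotone and $B_i:\mathcal H\to\mathcal H$ be monotone and $L_i$-Lipschitz continuous, $L_i\ge 0$, and suppose that $\big(\sum_{i=1}^N (A_i+B_i)\big)^{-1}(0)\neq\varnothing$. Write $A(\mathbf x)=A_1(x_1)\times\dots\times A_N(x_N)$ and $B(\mathbf x)=(B_1(x_1),\dots,B_N(x_N))$ for $\mathbf x\in\mathcal H^N$. Let $0<\alpha_i<1/(8L_i)$ for all $i$, $\Lambda=\mathrm{diag}(\alpha_1,\dots,\alpha_N)$, let $0<\beta<\|\Lambda^{1/2}((I-W)/2)\Lambda^{1/2}\|^{-1}$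 (spectral norm), and let $\widetilde W=I-(\beta/2)\Lambda(I-W)$; here $1/0=+\infty$. For a set-valued operator $T$ let $J_T=(I+T)^{-1}$ denote its resolvent. Let $\mathbf y^0,\mathbf z^0\in\mathcal H^N$ be arbitrary and consider Algorithm 1: set $$\mathbf v^0=B(\mathbf y^0),\quad \mathbf x^0=J_{\Lambda A}(\mathbf z^0),\quad \mathbf y^1=2\mathbf x^0-\mathbf z^0-\Lambda\mathbf v^0,\quad \mathbf z^1=\mathbf y^1+\mathbf z^0-\mathbf x^0,\quad \mathbf x^1=J_{\Lambda A}(\mathbf z^1),$$ and for $k\ge 1$ $$\begin{aligned}\mathbf v^k&=2B(\mathbf y^k)-B(\mathbf y^{k-1}),\\ \mathbf z^{k+1}&=\mathbf z^k-\mathbf x^k+\widetilde W\big(2\mathbf x^k-\mathbf x^{k-1}-\Lambda(\mathbf v^k-\mathbf v^{k-1})\big),\\ \mathbf x^{k+1}&=J_{\Lambda A}(\mathbf z^{k+1}),\\ \mathbf y^{k+1}&=\mathbf x^k+\mathbf z^{k+1}-\mathbf z^k.\end{aligned}$$ Then the algorithm is well defined (such sequences exist, each resolvent value being a single point), and its sequences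 satisfy, for some $\mathbf z^*,\mathbf x^*\in\mathcal H^N$: (i) $\mathbf z^k\rightharpoonup\mathbf z^*$ weakly in $\mathcal H^N$; (ii) $\mathbf x^k\rightharpoonup\mathbf x^*$ and $\mathbf y^k\rightharpoonup\mathbf x^*$ weakly in $\mathcal H^N$, where $\mathbf x^*=J_{\Lambda A}(\mathbf z^*)$; (iii) $\mathbf x^*=(x^*,\dots,x^*)$ for some $x^*\in\mathcal H$ with $0\in\sum_{i=1}^N(A_i+B_i)(x^*)$. -/

import Mathlib

open scoped NNReal RealInnerProductSpace Topology Pointwise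

namespace DistributedSplitting

section Operators

variable {E : Type*}

/-- The graph of a set-valued operator `A : E ⇉ E`. -/
def graph (A : E → Set E) : Set (E × E) := {p | p.2 ∈ A p.1}

/-- The inverse of a set-valued operator: `x ∈ A⁻¹ u` if and only if `u ∈ A x`. -/
def inverse (A : E → Set E) : E → Set E := fun u => {x | u ∈ A x}

/-- A single-valued operator regarded as a set-valued one. -/
def single (B : E → E) : E → Set E := fun x => {B x}

variable [NormedAddCommGroup E]

/-- The resolvent `J_A = (I + A)⁻¹`, as a set-valued operator. -/
def setResolvent (A : E → Set E) : E → Set E := inverse (fun x => single id x + A x)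

variable [InnerProductSpace ℝ E]

/-- Monotonicity of a set-valued operator. -/
def IsMonotone (A : E → Set E) : Prop :=
  ∀ p ∈ graph A, ∀ q ∈ graph A, 0 ≤ ⟪p.1 - q.1, p.2 - q.2⟫

/-- Maximal monotonicity: no monotone operator has a strictly larger graph. -/
def IsMaximallyMonotone (A : E → Set E) : Prop :=
  IsMonotone A ∧ ¬ ∃ A' : E → Set E, IsMonotone A' ∧ graph A ⊂ graph A'

/-- Weak convergence of a sequence. -/
def WeaklyConverges (u : ℕ → E) (a : E) : Prop :=
  Filter.Tendsto (fun k => toWeakSpace ℝ E (u k)) Filter.atTop (𝓝 (toWeakSpace ℝ E a))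

end Operators

section Matrices

variable {N : ℕ}

/-- The spectral norm of a real square matrix. -/
noncomputable def matrixSpectralNorm (M : Matrix (Fin N) (Fin N) ℝ) : ℝ :=
  ‖Matrix.toEuclideanCLM (n := Fin N) (𝕜 := ℝ) M‖

/-- Mixing matrices for a communication graph `G` on the nodes `Fin N`. -/
structure IsMixingMatrix (G : SimpleGraph (Fin N)) (W : Matrix (Fin N) (Fin N) ℝ) : Prop where
  eq_zero_of_not_adj : ∀ i j, i ≠ j → ¬ G.Adj i j → W i j = 0
  symm : W = W.transpose
  ker_eq : LinearMap.ker (Matrix.toLin' (1 - W)) = Submodule.span ℝ {fun _ => (1 : ℝ)}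
  neg_one_lt : (W - (-1)).PosDef
  le_one : (1 - W).PosSemidef

/-- The stepsize matrix `Λ = diag(α₁, …, α_N)`. -/
def stepMatrix (α : Fin N → ℝ) : Matrix (Fin N) (Fin N) ℝ := Matrix.diagonal α

/-- The matrix `Λ^{1/2} ((I - W) / 2) Λ^{1/2}`. -/
noncomputable def scaledLaplacian (α : Fin N → ℝ) (W : Matrix (Fin N) (Fin N) ℝ) :
    Matrix (Fin N) (Fin N) ℝ :=
  Matrix.diagonal (fun i => Real.sqrt (α i)) * ((1 / 2 : ℝ) • (1 - W)) *
    Matrix.diagonal (fun i => Real.sqrt (α i))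

/-- The matrix `W̃ = I - (β / 2) Λ (I - W)`. -/
noncomputable def modifiedMixing (α : Fin N → ℝ) (β : ℝ) (W : Matrix (Fin N) (Fin N) ℝ) :
    Matrix (Fin N) (Fin N) ℝ :=
  1 - (β / 2) • (stepMatrix α * (1 - W))

end Matrices

section Product

variable {N : ℕ} {H : Type*} [NormedAddCommGroup H] [InnerProductSpace ℝ H]

/-- The Hilbert product space `H^N`. -/
abbrev HilbertPower (N : ℕ) (H : Type*) : Type _ := PiLp 2 (fun _ : Fin N => H)

/-- The action of `M ⊗ I` on `H^N`. -/
noncomputable def kron (M : Matrix (Fin N) (Fin N) ℝ) (x : HilbertPower N H) : HilbertPower N H :=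
  WithLp.toLp 2 (fun i => ∑ j, M i j • x j)

/-- The product operator `A(𝐱) = A₁(x₁) × ⋯ × A_N(x_N)`. -/
def prodOp (A : Fin N → H → Set H) : HilbertPower N H → Set (HilbertPower N H) :=
  fun x => {u | ∀ i, u i ∈ A i (x i)}

/-- The product operator `B(𝐱) = (B₁(x₁), …, B_N(x_N))`. -/
def prodFun (B : Fin N → H → H) (x : HilbertPower N H) : HilbertPower N H :=
  WithLp.toLp 2 (fun i => B i (x i))

/-- The set-valued operator `Λ A` on `H^N`. -/
noncomputable def scaledOp (α : Fin N → ℝ) (A : Fin N → H → Set H) :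
    HilbertPower N H → Set (HilbertPower N H) :=
  fun x => kron (stepMatrix α) '' prodOp A x

/-- The diagonal vector `(p, …, p)`. -/
def consensus (N : ℕ) {H : Type*} (p : H) : HilbertPower N H := WithLp.toLp 2 (fun _ => p)

/-- The set-valued operator `∑ᵢ (Aᵢ + Bᵢ)`. -/
def sumOp (A : Fin N → H → Set H) (B : Fin N → H → H) : H → Set H :=
  fun z => ∑ i, (A i z + single (B i) z)

/-- The sequences `x, y, z, v` are generated by the algorithm with operators `A, B`, step sizes
`α`, parameter `β`, mixing matrix `W` and initial points `y0, z0`. A singleton value of the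
resolvent expresses `xᵏ = J_{ΛA}(zᵏ)`. -/
structure IsRun (A : Fin N → H → Set H) (B : Fin N → H → H) (α : Fin N → ℝ) (β : ℝ)
    (W : Matrix (Fin N) (Fin N) ℝ) (y0 z0 : HilbertPower N H) (x y z v : ℕ → HilbertPower N H) : Prop where
  y_zero : y 0 = y0
  z_zero : z 0 = z0
  v_zero : v 0 = prodFun B (y 0)
  x_zero : setResolvent (scaledOp α A) (z 0) = {x 0}
  y_one : y 1 = (2 : ℝ) • x 0 - z 0 - kron (stepMatrix α) (v 0)
  z_one : z 1 = y 1 + z 0 - x 0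
  x_one : setResolvent (scaledOp α A) (z 1) = {x 1}
  v_step : ∀ k ≥ 1, v k = (2 : ℝ) • prodFun B (y k) - prodFun B (y (k - 1))
  z_step : ∀ k ≥ 1, z (k + 1) = z k - x k +
    kron (modifiedMixing α β W)
      ((2 : ℝ) • x k - x (k - 1) - kron (stepMatrix α) (v k - v (k - 1)))
  x_step : ∀ k ≥ 1, setResolvent (scaledOp α A) (z (k + 1)) = {x (k + 1)}
  y_step : ∀ k ≥ 1, y (k + 1) = x k + z (k + 1) - z k

end Product

end DistributedSplitting

namespace DistributedSplitting

section Minty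

/-- A closed convex subset of `X × ℝ` contains a point minimizing `t + ‖x‖² / 2`, and this point
satisfies the first-order optimality condition. -/
theorem exists_variational_minimizer {X : Type*} [NormedAddCommGroup X] [InnerProductSpace ℝ X]
    [CompleteSpace X] {D : Set (X × ℝ)} (hconv : Convex ℝ D) (hclosed : IsClosed D)
    (hne : D.Nonempty) (hpos : ∀ p ∈ D, 0 ≤ p.2 + ‖p.1‖ ^ 2 / 2) :
    ∃ p ∈ D, ∀ q ∈ D, p.2 ≤ q.2 + ⟪p.1, q.1 - p.1⟫ := by
  set f : X × ℝ → ℝ := fun p => p.2 + ‖p.1‖ ^ 2 / 2 with hf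
  set m := sInf (f '' D) with hm
  have hbdd : BddBelow (f '' D) := ⟨0, by rintro _ ⟨p, hp, rfl⟩; exact hpos p hp⟩
  have hle : ∀ p ∈ D, m ≤ f p := fun p hp => csInf_le hbdd ⟨p, hp, rfl⟩
  have hex : ∀ n : ℕ, ∃ p ∈ D, f p < m + 1 / ((n : ℝ) + 1) := by
    intro n
    obtain ⟨_, ⟨p, hp, rfl⟩, h⟩ := exists_lt_of_csInf_lt (hne.image f)
      (show m < m + 1 / ((n : ℝ) + 1) by linarith [Nat.one_div_pos_of_nat (α := ℝ) (n := n)])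
    exact ⟨p, hp, h⟩
  choose p hpD hpm using hex
  have hlim1 : Filter.Tendsto (fun n : ℕ => 1 / ((n : ℝ) + 1)) Filter.atTop (𝓝 0) :=
    tendsto_one_div_add_atTop_nhds_zero_nat
  have hmid : ∀ a ∈ D, ∀ b ∈ D, ‖a.1 - b.1‖ ^ 2 / 8 ≤ (f a + f b) / 2 - m := by
    intro a ha b hb
    have h1 := hle _ (hconv ha hb (by norm_num : (0 : ℝ) ≤ 1 / 2) (by norm_num : (0 : ℝ) ≤ 1 / 2)
      (by norm_num))
    have h2 := parallelogram_law_with_norm ℝ a.1 b.1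
    have h3 : ‖(1 / 2 : ℝ) • a.1 + (1 / 2 : ℝ) • b.1‖ ^ 2 = ‖a.1 + b.1‖ ^ 2 / 4 := by
      rw [← smul_add, norm_smul, mul_pow]; norm_num; ring
    simp only [hf, Prod.fst_add, Prod.smul_fst, Prod.snd_add, Prod.smul_snd, smul_eq_mul, h3] at h1 ⊢
    nlinarith
  have hcau : CauchySeq (fun n => (p n).1) := by
    refine cauchySeq_of_le_tendsto_0 (fun n : ℕ => √(8 * (1 / ((n : ℝ) + 1)))) ?_ ?_
    · intro n k j hn hk
      rw [dist_eq_norm]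
      refine Real.le_sqrt_of_sq_le ?_
      have h := hmid _ (hpD n) _ (hpD k)
      have h1 := Nat.one_div_le_one_div (α := ℝ) hn
      have h2 := Nat.one_div_le_one_div (α := ℝ) hk
      linarith [hpm n, hpm k]
    · simpa using ((hlim1.const_mul 8).sqrt)
  obtain ⟨x, hx⟩ := cauchySeq_tendsto_of_complete hcau
  have hfm : Filter.Tendsto (fun n => f (p n)) Filter.atTop (𝓝 m) :=
    tendsto_of_tendsto_of_tendsto_of_le_of_le tendsto_const_nhds
      (by simpa using hlim1.const_add m) (fun n => hle _ (hpD n)) (fun n => (hpm n).le)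
  have ht : Filter.Tendsto (fun n => (p n).2) Filter.atTop (𝓝 (m - ‖x‖ ^ 2 / 2)) := by
    have := hfm.sub ((hx.norm.pow 2).div_const 2)
    simpa [hf] using this
  refine ⟨(x, m - ‖x‖ ^ 2 / 2), hclosed.mem_of_tendsto (hx.prodMk_nhds ht)
    (Filter.Eventually.of_forall hpD), ?_⟩
  have hmemD : (x, m - ‖x‖ ^ 2 / 2) ∈ D := hclosed.mem_of_tendsto (hx.prodMk_nhds ht)
    (Filter.Eventually.of_forall hpD)
  intro q hq
  by_contra! hlt
  set c := q.2 - (m - ‖x‖ ^ 2 / 2) + ⟪x, q.1 - x⟫ with hc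
  set d := ‖q.1 - x‖ ^ 2 with hd
  have hc0 : c < 0 := by simp only at hlt; linarith
  have hd0 : 0 ≤ d := by positivity
  have key : ∀ s : ℝ, 0 < s → s ≤ 1 → 0 ≤ c + s * d / 2 := by
    intro s hs hs1
    have h1 := hle _ (hconv hmemD hq (sub_nonneg.2 hs1) hs.le (by ring))
    have h2 : (1 - s) • x + s • q.1 = x + s • (q.1 - x) := by module
    have h3 : ‖x + s • (q.1 - x)‖ ^ 2 = ‖x‖ ^ 2 + 2 * (s * ⟪x, q.1 - x⟫) + s ^ 2 * d := by
      rw [norm_add_sq_real, inner_smul_right, norm_smul, mul_pow, Real.norm_eq_abs, sq_abs]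
    simp only [hf, Prod.fst_add, Prod.smul_fst, Prod.snd_add, Prod.smul_snd, smul_eq_mul, h2,
      h3] at h1
    have h4 : 0 ≤ s * (c + s * d / 2) := by rw [hc]; linarith
    exact nonneg_of_mul_nonneg_right h4 hs
  have hs0 : 0 < min 1 (-c / (d + 1)) := lt_min one_pos (div_pos (by linarith) (by linarith))
  have h1 := key _ hs0 (min_le_left _ _)
  have h2 : min 1 (-c / (d + 1)) * (d + 1) ≤ -c := by
    have := mul_le_mul_of_nonneg_right (min_le_right 1 (-c / (d + 1))) (by linarith : 0 ≤ d + 1)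
    rwa [div_mul_cancel₀ _ (by linarith : d + 1 ≠ 0)] at this
  nlinarith

variable {H : Type*} [NormedAddCommGroup H] [InnerProductSpace ℝ H]

theorem isMonotone_iff {A : H → Set H} :
    IsMonotone A ↔ ∀ x u y v, u ∈ A x → v ∈ A y → 0 ≤ ⟪x - y, u - v⟫ :=
  ⟨fun h x u y v hu hv => h (x, u) hu (y, v) hv, fun h _ hp _ hq => h _ _ _ _ hp hq⟩

theorem IsMonotone.inner_nonneg {A : H → Set H} (hA : IsMonotone A) {x u y v : H} (hu : u ∈ A x)
    (hv : v ∈ A y) : 0 ≤ ⟪x - y, u - v⟫ :=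
  isMonotone_iff.1 hA x u y v hu hv

theorem IsMaximallyMonotone.mem_of_inner_nonneg {A : H → Set H} (hA : IsMaximallyMonotone A)
    {x u : H} (h : ∀ w a, a ∈ A w → 0 ≤ ⟪x - w, u - a⟫) : u ∈ A x := by
  by_contra hu
  refine hA.2 ⟨fun w => A w ∪ {a | w = x ∧ a = u}, ?_, ?_⟩
  · rw [isMonotone_iff]
    rintro w a w' a' (ha | ⟨rfl, rfl⟩) (ha' | ⟨rfl, rfl⟩)
    · exact hA.1.inner_nonneg ha ha'
    · have := h _ _ ha
      rwa [← neg_sub, ← neg_sub a, inner_neg_neg] at this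
    · exact h _ _ ha'
    · simp
  · refine ⟨fun p hp => Or.inl hp, fun hsub => hu ?_⟩
    exact hsub (show (x, u) ∈ graph _ from Or.inr ⟨rfl, rfl⟩)

/-- **Minty's theorem**, in the form `0 ∈ ran (I + A)`. -/
theorem exists_neg_mem_of_maximal [CompleteSpace H] {A : H → Set H}
    (hmono : ∀ x u y v, u ∈ A x → v ∈ A y → 0 ≤ ⟪x - y, u - v⟫)
    (hmax : ∀ x u, (∀ w a, a ∈ A w → 0 ≤ ⟪x - w, u - a⟫) → u ∈ A x) :
    ∃ x, -x ∈ A x := by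
  let D : Set (WithLp 2 (H × H) × ℝ) :=
    {p | ∀ w a, a ∈ A w → ⟪p.1.fst, a⟫ + ⟪w, p.1.snd⟫ - ⟪w, a⟫ ≤ p.2}
  have hfst : Continuous fun p : WithLp 2 (H × H) × ℝ => p.1.fst := by fun_prop
  have hsnd : Continuous fun p : WithLp 2 (H × H) × ℝ => p.1.snd := by fun_prop
  have hclosed : IsClosed D := by
    simp only [D, Set.ofPred_forall]
    refine isClosed_iInter fun w => isClosed_iInter fun a => isClosed_iInter fun _ => ?_
    exact isClosed_le (((hfst.inner continuous_const).add (continuous_const.inner hsnd)).sub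
      continuous_const) continuous_snd
  have hconv : Convex ℝ D := by
    intro p hp q hq s t hs ht hst w a ha
    have h1 := mul_le_mul_of_nonneg_left (hp w a ha) hs
    have h2 := mul_le_mul_of_nonneg_left (hq w a ha) ht
    have h3 : ⟪w, a⟫ = s * ⟪w, a⟫ + t * ⟪w, a⟫ := by rw [← add_mul, hst, one_mul]
    simp only [Prod.fst_add, Prod.smul_fst, Prod.snd_add, Prod.smul_snd, WithLp.add_fst,
      WithLp.smul_fst, WithLp.add_snd, WithLp.smul_snd, inner_add_left, inner_add_right,
      inner_smul_left, inner_smul_right, smul_eq_mul, conj_trivial]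
    linarith
  have hgraph : ∀ x u, u ∈ A x → ((WithLp.toLp 2 (x, u) : WithLp 2 (H × H)), ⟪x, u⟫) ∈ D := by
    intro x u hu w a ha
    have := hmono x u w a hu ha
    simp only [inner_sub_left, inner_sub_right] at this
    show ⟪x, a⟫ + ⟪w, u⟫ - ⟪w, a⟫ ≤ ⟪x, u⟫
    linarith
  have hbelow : ∀ p ∈ D, ⟪p.1.fst, p.1.snd⟫ ≤ p.2 := by
    intro p hp
    by_contra! hlt
    have hmem : p.1.snd ∈ A p.1.fst := by
      refine hmax _ _ fun w a ha => ?_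
      have := hp w a ha
      simp only [inner_sub_left, inner_sub_right]
      linarith
    have := hp _ _ hmem
    linarith
  have hne : D.Nonempty := by
    by_cases h : ∃ x u, u ∈ A x
    · obtain ⟨x, u, hu⟩ := h
      exact ⟨_, hgraph x u hu⟩
    · push Not at h
      exact (h 0 0 (hmax 0 0 fun w a ha => (h w a ha).elim)).elim
  have hpos : ∀ p ∈ D, 0 ≤ p.2 + ‖p.1‖ ^ 2 / 2 := by
    intro p hp
    have h1 := hbelow p hp
    have h2 := sq_nonneg ‖p.1.fst + p.1.snd‖
    rw [norm_add_sq_real] at h2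
    rw [WithLp.prod_norm_sq_eq_of_L2]
    linarith
  obtain ⟨p, hp, hopt⟩ := exists_variational_minimizer hconv hclosed hne hpos
  have hsum : ‖p.1.fst + p.1.snd‖ ^ 2
      = ‖p.1.fst‖ ^ 2 + 2 * ⟪p.1.fst, p.1.snd⟫ + ‖p.1.snd‖ ^ 2 := norm_add_sq_real _ _
  have key : ∀ w a, a ∈ A w →
      ‖p.1.fst + p.1.snd‖ ^ 2 ≤ ⟪-p.1.snd - w, -p.1.fst - a⟫ := by
    intro w a ha
    have h1 := hopt _ (hgraph w a ha)
    have h2 := hbelow p hp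
    simp only [WithLp.prod_inner_apply,
      inner_sub_right, inner_sub_left, inner_neg_left, inner_neg_right] at h1 ⊢
    have h3 := real_inner_self_eq_norm_sq p.1.fst
    have h4 := real_inner_self_eq_norm_sq p.1.snd
    have h5 := real_inner_comm p.1.fst p.1.snd
    have h6 := real_inner_comm p.1.fst w
    simp only [WithLp.fst, WithLp.snd] at *
    linarith
  have hmem : -p.1.fst ∈ A (-p.1.snd) :=
    hmax _ _ fun w a ha => (sq_nonneg _).trans (key w a ha)
  have h0 := key _ _ hmem
  rw [sub_self, inner_zero_left] at h0
  have h1 : p.1.fst + p.1.snd = 0 := by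
    rw [← norm_eq_zero]; exact pow_eq_zero_iff two_ne_zero |>.1 (le_antisymm h0 (sq_nonneg _))
  refine ⟨p.1.fst, ?_⟩
  rwa [← eq_neg_of_add_eq_zero_left h1] at hmem

theorem IsMaximallyMonotone.exists_resolvent [CompleteSpace H] {A : H → Set H}
    (hA : IsMaximallyMonotone A) {α : ℝ} (hα : 0 < α) (z : H) : ∃ x, α⁻¹ • (z - x) ∈ A x := by
  have hinner : ∀ d u v : H, ⟪d, α⁻¹ • (z + u) - α⁻¹ • (z + v)⟫ = α⁻¹ * ⟪d, u - v⟫ := by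
    intro d u v
    rw [← smul_sub, inner_smul_right, add_sub_add_left_eq_sub]
  have h := exists_neg_mem_of_maximal (A := fun x => {u | α⁻¹ • (z + u) ∈ A x}) ?_ ?_
  · obtain ⟨x, hx⟩ := h
    exact ⟨x, by simpa [sub_eq_add_neg] using hx⟩
  · intro x u y v hu hv
    have := hA.1.inner_nonneg hu hv
    rw [hinner] at this
    exact nonneg_of_mul_nonneg_right this (inv_pos.2 hα)
  · intro x u h
    refine hA.mem_of_inner_nonneg fun w a ha => ?_
    have h1 : α⁻¹ • (z + (α • a - z)) = a := by
      rw [add_sub_cancel, inv_smul_smul₀ hα.ne']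
    have h2 := hinner (x - w) u (α • a - z)
    rw [h1] at h2
    rw [h2]
    exact mul_nonneg (inv_pos.2 hα).le (h w (α • a - z) (show _ ∈ A w from h1.symm ▸ ha))

theorem IsMonotone.resolvent_inner_nonneg {A : H → Set H} (hA : IsMonotone A) {α : ℝ} (hα : 0 < α)
    {z z' x x' : H} (hx : α⁻¹ • (z - x) ∈ A x) (hx' : α⁻¹ • (z' - x') ∈ A x') :
    0 ≤ ⟪x - x', (z - x) - (z' - x')⟫ := by
  have := hA.inner_nonneg hx hx'
  rw [← smul_sub, inner_smul_right] at this
  exact nonneg_of_mul_nonneg_right this (inv_pos.2 hα)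

end Minty

section ProductResolvent

variable {N : ℕ} {H : Type*} [NormedAddCommGroup H] [InnerProductSpace ℝ H]

theorem kron_stepMatrix_apply (α : Fin N → ℝ) (x : HilbertPower N H) (i : Fin N) :
    kron (stepMatrix α) x i = α i • x i := by
  simp [kron, stepMatrix, Matrix.diagonal_apply, ite_smul]

theorem mem_setResolvent_scaledOp {α : Fin N → ℝ} (hα : ∀ i, 0 < α i) {A : Fin N → H → Set H}
    {x z : HilbertPower N H} :
    x ∈ setResolvent (scaledOp α A) z ↔ ∀ i, (α i)⁻¹ • (z i - x i) ∈ A i (x i) := by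
  simp only [setResolvent, inverse, single, id, Set.mem_ofPred_eq, Set.singleton_add, scaledOp,
    Set.mem_image, exists_exists_and_eq_and]
  constructor
  · rintro ⟨u, hu, rfl⟩ i
    simpa [kron_stepMatrix_apply, inv_smul_smul₀ (hα i).ne'] using hu i
  · intro h
    refine ⟨WithLp.toLp 2 fun i => (α i)⁻¹ • (z i - x i), h, ?_⟩
    ext i
    simp [kron_stepMatrix_apply, smul_inv_smul₀ (hα i).ne']

theorem setResolvent_scaledOp_eq_singleton_iff {α : Fin N → ℝ} (hα : ∀ i, 0 < α i)
    {A : Fin N → H → Set H} (hA : ∀ i, IsMonotone (A i)) {x z : HilbertPower N H} :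
    setResolvent (scaledOp α A) z = {x} ↔ ∀ i, (α i)⁻¹ • (z i - x i) ∈ A i (x i) := by
  rw [← mem_setResolvent_scaledOp hα]
  refine ⟨fun h => h ▸ rfl, fun h => Set.eq_singleton_iff_unique_mem.2 ⟨h, fun x' h' => ?_⟩⟩
  rw [mem_setResolvent_scaledOp hα] at h h'
  ext i
  have := (hA i).resolvent_inner_nonneg (hα i) (h' i) (h i)
  rw [sub_sub_sub_cancel_left, ← neg_sub (x' i), inner_neg_right, real_inner_self_eq_norm_sq] at this
  have h0 : ‖x' i - x i‖ = 0 := pow_eq_zero_iff two_ne_zero |>.1 (le_antisymm (by linarith)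
    (sq_nonneg _))
  exact sub_eq_zero.1 (norm_eq_zero.1 h0)

theorem exists_setResolvent_scaledOp_eq_singleton [CompleteSpace H] {α : Fin N → ℝ}
    (hα : ∀ i, 0 < α i) {A : Fin N → H → Set H} (hA : ∀ i, IsMaximallyMonotone (A i))
    (z : HilbertPower N H) : ∃ x, setResolvent (scaledOp α A) z = {x} := by
  choose x hx using fun i => (hA i).exists_resolvent (hα i) (z i)
  exact ⟨WithLp.toLp 2 x, (setResolvent_scaledOp_eq_singleton_iff hα fun i => (hA i).1).2 hx⟩

end ProductResolvent

section OneStep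

variable {H : Type*} [NormedAddCommGroup H] [InnerProductSpace ℝ H]

theorem norm_le_of_inner_sub_nonneg {d e : H} (h : 0 ≤ ⟪d, e - d⟫) :
    ‖d‖ ≤ ‖e‖ ∧ ‖e - d‖ ≤ ‖e‖ := by
  have h1 : ‖e‖ ^ 2 = ‖d‖ ^ 2 + 2 * ⟪d, e - d⟫ + ‖e - d‖ ^ 2 := by
    rw [← norm_add_sq_real, add_sub_cancel]
  constructor <;> refine le_of_sq_le_sq ?_ (norm_nonneg _)
  · nlinarith [sq_nonneg ‖e - d‖]
  · nlinarith [sq_nonneg ‖d‖]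

/-- The increments of the forward points are controlled by those of the governing sequence. -/
theorem norm_forward_sub_le {x₁ x₂ z₁ z₂ z₃ : H}
    (h : 0 ≤ ⟪x₂ - x₁, (z₂ - x₂) - (z₁ - x₁)⟫) :
    ‖(x₂ + z₃ - z₂) - (x₁ + z₂ - z₁)‖ ≤ ‖z₃ - z₂‖ + ‖z₂ - z₁‖ := by
  have h1 : (z₂ - x₂) - (z₁ - x₁) = (z₂ - z₁) - (x₂ - x₁) := by abel
  rw [h1] at h
  have h2 : (x₂ + z₃ - z₂) - (x₁ + z₂ - z₁) = (z₃ - z₂) - ((z₂ - z₁) - (x₂ - x₁)) := by abel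
  rw [h2]
  exact (norm_sub_le _ _).trans (by gcongr; exact (norm_le_of_inner_sub_nonneg h).2)

theorem inner_governing_step_le {α : ℝ} (hα : 0 < α) {x₂ z₂ z₃ xs zs g gs : H}
    (hz₃ : z₃ = x₂ - α • g) (hzs : zs = xs - α • gs)
    (h : 0 ≤ ⟪x₂ - xs, (z₂ - x₂) - (zs - xs)⟫) :
    1 / 2 * α⁻¹ * (‖z₃ - zs‖ ^ 2 - ‖z₂ - zs‖ ^ 2 + ‖z₃ - z₂‖ ^ 2)
      ≤ -⟪x₂ + z₃ - z₂ - xs, g - gs⟫ := by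
  obtain ⟨X, rfl⟩ : ∃ X, x₂ = xs + X := ⟨x₂ - xs, by abel⟩
  obtain ⟨Z₂, rfl⟩ : ∃ Z, z₂ = zs + Z := ⟨z₂ - zs, by abel⟩
  obtain ⟨Z₃, rfl⟩ : ∃ Z, z₃ = zs + Z := ⟨z₃ - zs, by abel⟩
  have hg : g - gs = α⁻¹ • (X - Z₃) := by
    have : X - Z₃ = α • (g - gs) := by
      have h1 : Z₃ = xs + X - α • g - zs := by rw [← hz₃]; abel
      rw [h1, hzs]; module
    rw [this, inv_smul_smul₀ hα.ne']
  have e1 : xs + X + (zs + Z₃) - (zs + Z₂) - xs = X + Z₃ - Z₂ := by abel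
  have e2 : zs + Z₃ - (zs + Z₂) = Z₃ - Z₂ := by abel
  have e3 : zs + Z₂ - (xs + X) - (zs - xs) = Z₂ - X := by abel
  rw [add_sub_cancel_left, e3] at h
  rw [hg, e1, e2, add_sub_cancel_left, add_sub_cancel_left, inner_smul_right]
  have key : 1 / 2 * (‖Z₃‖ ^ 2 - ‖Z₂‖ ^ 2 + ‖Z₃ - Z₂‖ ^ 2) ≤ -⟪X + Z₃ - Z₂, X - Z₃⟫ := by
    rw [norm_sub_sq_real]
    simp only [inner_sub_left, inner_sub_right, inner_add_left, real_inner_self_eq_norm_sq] at h ⊢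
    linarith [real_inner_comm X Z₃, real_inner_comm X Z₂, real_inner_comm Z₂ Z₃]
  have := mul_le_mul_of_nonneg_left key (inv_pos.2 hα).le
  linarith

theorem neg_inner_reflected_le {B : H → H} {L : ℝ} (hL : 0 ≤ L)
    (hmono : ∀ x y, 0 ≤ ⟪x - y, B x - B y⟫) (hlip : ∀ x y, ‖B x - B y‖ ≤ L * ‖x - y‖)
    {y₁ y₂ y₃ : H} (xs : H) {d₁ d₂ d₃ : ℝ} (h₂ : ‖y₂ - y₁‖ ≤ d₂ + d₁) (h₃ : ‖y₃ - y₂‖ ≤ d₃ + d₂) :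
    -⟪y₃ - xs, (2 : ℝ) • B y₂ - B y₁ - B xs⟫ ≤ ⟪y₃ - xs, B y₃ - B y₂⟫ - ⟪y₂ - xs, B y₂ - B y₁⟫
      + L * (d₃ ^ 2 + 2 * d₂ ^ 2 + d₁ ^ 2) := by
  have h := hmono y₃ xs
  have hcs : -⟪y₃ - y₂, B y₂ - B y₁⟫ ≤ ‖y₃ - y₂‖ * ‖B y₂ - B y₁‖ :=
    (neg_le_abs _).trans (abs_real_inner_le_norm _ _)
  have hb : ‖y₃ - y₂‖ * ‖B y₂ - B y₁‖ ≤ L * (d₃ ^ 2 + 2 * d₂ ^ 2 + d₁ ^ 2) := by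
    calc ‖y₃ - y₂‖ * ‖B y₂ - B y₁‖ ≤ (d₃ + d₂) * (L * (d₂ + d₁)) := by
          have := hlip y₂ y₁
          have h0 := norm_nonneg (y₃ - y₂)
          gcongr
          · linarith
          · exact this.trans (by gcongr)
      _ = L * ((d₃ + d₂) * (d₂ + d₁)) := by ring
      _ ≤ _ := by
          gcongr
          nlinarith [sq_nonneg (d₃ - d₂), sq_nonneg (d₂ - d₁), sq_nonneg (d₃ + d₂ - d₂ - d₁)]
  have e : -⟪y₃ - xs, (2 : ℝ) • B y₂ - B y₁ - B xs⟫ = -⟪y₃ - xs, B y₃ - B xs⟫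
      + ⟪y₃ - xs, B y₃ - B y₂⟫ - ⟪y₂ - xs, B y₂ - B y₁⟫ - ⟪y₃ - y₂, B y₂ - B y₁⟫ := by
    simp only [inner_sub_left, inner_sub_right, inner_smul_right]
    ring
  linarith

/-- The Lyapunov energy of one agent: `z` and `z'` are consecutive governing points, `y` and `y'`
the corresponding forward points, and `d` is the preceding governing increment. -/
noncomputable def agentEnergy (α L : ℝ) (B : H → H) (xs zs z z' y y' : H) (d : ℝ) : ℝ :=
  1 / 2 * α⁻¹ * ‖z' - zs‖ ^ 2 - ⟪y' - xs, B y' - B y⟫ + 3 * L * ‖z' - z‖ ^ 2 + L * d ^ 2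

theorem agentEnergy_step {B : H → H} {α L : ℝ} (hα : 0 < α) (hL : 0 ≤ L)
    (hmono : ∀ x y, 0 ≤ ⟪x - y, B x - B y⟫) (hlip : ∀ x y, ‖B x - B y‖ ≤ L * ‖x - y‖)
    {x₀ x₁ x₂ z₀ z₁ z₂ z₃ y₁ y₂ y₃ xs zs q qs : H}
    (hy₁ : y₁ = x₀ + z₁ - z₀) (hy₂ : y₂ = x₁ + z₂ - z₁) (hy₃ : y₃ = x₂ + z₃ - z₂)
    (hz₃ : z₃ = x₂ - α • ((2 : ℝ) • B y₂ - B y₁ + q)) (hzs : zs = xs - α • (B xs + qs))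
    (hs : 0 ≤ ⟪x₂ - xs, (z₂ - x₂) - (zs - xs)⟫)
    (h₂ : 0 ≤ ⟪x₂ - x₁, (z₂ - x₂) - (z₁ - x₁)⟫) (h₁ : 0 ≤ ⟪x₁ - x₀, (z₁ - x₁) - (z₀ - x₀)⟫) :
    agentEnergy α L B xs zs z₂ z₃ y₂ y₃ ‖z₂ - z₁‖ + (1 / 2 * α⁻¹ - 4 * L) * ‖z₃ - z₂‖ ^ 2
      + ⟪y₃ - xs, q - qs⟫ ≤ agentEnergy α L B xs zs z₁ z₂ y₁ y₂ ‖z₁ - z₀‖ := by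
  have hA := inner_governing_step_le hα hz₃ hzs hs
  rw [← hy₃] at hA
  have hd₂ : ‖y₂ - y₁‖ ≤ ‖z₂ - z₁‖ + ‖z₁ - z₀‖ := by
    rw [hy₁, hy₂]; exact norm_forward_sub_le h₁
  have hd₃ : ‖y₃ - y₂‖ ≤ ‖z₃ - z₂‖ + ‖z₂ - z₁‖ := by
    rw [hy₃, hy₂]; exact norm_forward_sub_le h₂
  have hB := neg_inner_reflected_le hL hmono hlip xs hd₂ hd₃
  have e : ⟪y₃ - xs, (2 : ℝ) • B y₂ - B y₁ + q - (B xs + qs)⟫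
      = ⟪y₃ - xs, (2 : ℝ) • B y₂ - B y₁ - B xs⟫ + ⟪y₃ - xs, q - qs⟫ := by
    rw [← inner_add_right]; congr 1; abel
  rw [e] at hA
  unfold agentEnergy
  linarith

theorem abs_inner_forward_le {B : H → H} {L : ℝ} (hL : 0 ≤ L)
    (hlip : ∀ x y, ‖B x - B y‖ ≤ L * ‖x - y‖) {x₁ x₂ z₁ z₂ z₃ y₂ y₃ xs zs : H}
    (hy₂ : y₂ = x₁ + z₂ - z₁) (hy₃ : y₃ = x₂ + z₃ - z₂)
    (hs : 0 ≤ ⟪x₂ - xs, (z₂ - x₂) - (zs - xs)⟫)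
    (h₂ : 0 ≤ ⟪x₂ - x₁, (z₂ - x₂) - (z₁ - x₁)⟫) :
    |⟪y₃ - xs, B y₃ - B y₂⟫|
      ≤ L * ((2 * ‖z₃ - zs‖ + ‖z₃ - z₂‖) * (‖z₃ - z₂‖ + ‖z₂ - z₁‖)) := by
  have hd₃ : ‖y₃ - y₂‖ ≤ ‖z₃ - z₂‖ + ‖z₂ - z₁‖ := by
    rw [hy₃, hy₂]; exact norm_forward_sub_le h₂
  have hys : ‖y₃ - xs‖ ≤ 2 * ‖z₃ - zs‖ + ‖z₃ - z₂‖ := by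
    have e1 : (z₂ - x₂) - (zs - xs) = (z₂ - zs) - (x₂ - xs) := by abel
    rw [e1] at hs
    have e2 : y₃ - xs = (z₃ - zs) - ((z₂ - zs) - (x₂ - xs)) := by rw [hy₃]; abel
    have e3 : z₂ - zs = (z₃ - zs) - (z₃ - z₂) := by abel
    have h3 := (norm_le_of_inner_sub_nonneg hs).2
    have h4 := norm_sub_le (z₃ - zs) ((z₂ - zs) - (x₂ - xs))
    have h5 := norm_sub_le (z₃ - zs) (z₃ - z₂)
    rw [← e3] at h5
    rw [e2]
    linarith
  calc _ ≤ ‖y₃ - xs‖ * ‖B y₃ - B y₂‖ := abs_real_inner_le_norm _ _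
    _ ≤ (2 * ‖z₃ - zs‖ + ‖z₃ - z₂‖) * (L * (‖z₃ - z₂‖ + ‖z₂ - z₁‖)) := by
        gcongr
        exact (hlip _ _).trans (by gcongr)
    _ = _ := by ring

theorem le_agentEnergy {B : H → H} {α L : ℝ} (hL : 0 ≤ L)
    (hlip : ∀ x y, ‖B x - B y‖ ≤ L * ‖x - y‖) {x₁ x₂ z₁ z₂ z₃ y₂ y₃ xs zs : H}
    (hy₂ : y₂ = x₁ + z₂ - z₁) (hy₃ : y₃ = x₂ + z₃ - z₂)
    (hs : 0 ≤ ⟪x₂ - xs, (z₂ - x₂) - (zs - xs)⟫)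
    (h₂ : 0 ≤ ⟪x₂ - x₁, (z₂ - x₂) - (z₁ - x₁)⟫) :
    (1 / 2 * α⁻¹ - 3 * L) * ‖z₃ - zs‖ ^ 2 ≤ agentEnergy α L B xs zs z₂ z₃ y₂ y₃ ‖z₂ - z₁‖ := by
  have h := (le_abs_self _).trans (abs_inner_forward_le hL hlip hy₂ hy₃ hs h₂)
  have h' : (2 * ‖z₃ - zs‖ + ‖z₃ - z₂‖) * (‖z₃ - z₂‖ + ‖z₂ - z₁‖)
      ≤ 3 * ‖z₃ - zs‖ ^ 2 + 3 * ‖z₃ - z₂‖ ^ 2 + ‖z₂ - z₁‖ ^ 2 := by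
    nlinarith [sq_nonneg (‖z₃ - zs‖ - ‖z₃ - z₂‖), sq_nonneg (2 * ‖z₃ - zs‖ - ‖z₂ - z₁‖),
      sq_nonneg (‖z₃ - z₂‖ - ‖z₂ - z₁‖), sq_nonneg (‖z₃ - zs‖ - ‖z₂ - z₁‖),
      sq_nonneg (2 * ‖z₃ - zs‖ - 3 * ‖z₃ - z₂‖)]
  have := mul_le_mul_of_nonneg_left h' hL
  unfold agentEnergy
  linarith

end OneStep

section Kronecker

variable {N : ℕ} {H : Type*} [NormedAddCommGroup H] [InnerProductSpace ℝ H]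

theorem kron_apply (M : Matrix (Fin N) (Fin N) ℝ) (x : HilbertPower N H) (i : Fin N) :
    kron M x i = ∑ j, M i j • x j := rfl

/-- The action of `M ⊗ I` as a continuous linear map. -/
noncomputable def kronL (M : Matrix (Fin N) (Fin N) ℝ) : HilbertPower N H →L[ℝ] HilbertPower N H where
  toFun := kron M
  map_add' x y := by ext i; simp [kron_apply, Finset.sum_add_distrib]
  map_smul' c x := by ext i; simp [kron_apply, Finset.smul_sum, smul_comm c]
  cont := by unfold kron; fun_prop

theorem kronL_apply (M : Matrix (Fin N) (Fin N) ℝ) (x : HilbertPower N H) :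
    kronL M x = kron M x := rfl

theorem kron_mul (M M' : Matrix (Fin N) (Fin N) ℝ) (x : HilbertPower N H) :
    kron (M * M') x = kron M (kron M' x) := by
  ext i
  simp only [kron_apply, Matrix.mul_apply, Finset.sum_smul, Finset.smul_sum, mul_smul]
  exact Finset.sum_comm

theorem kron_add (M M' : Matrix (Fin N) (Fin N) ℝ) (x : HilbertPower N H) :
    kron (M + M') x = kron M x + kron M' x := by
  ext i; simp [kron_apply, add_smul, Finset.sum_add_distrib]

theorem kron_sub (M M' : Matrix (Fin N) (Fin N) ℝ) (x : HilbertPower N H) :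
    kron (M - M') x = kron M x - kron M' x := by
  ext i; simp [kron_apply, sub_smul, Finset.sum_sub_distrib]

theorem kron_smul (c : ℝ) (M : Matrix (Fin N) (Fin N) ℝ) (x : HilbertPower N H) :
    kron (c • M) x = c • kron M x := by
  ext i; simp [kron_apply, Finset.smul_sum, mul_smul]

theorem kron_one (x : HilbertPower N H) : kron 1 x = x := by
  ext i; simp [kron_apply, Matrix.one_apply, ite_smul]

theorem inner_kron_left (M : Matrix (Fin N) (Fin N) ℝ) (x y : HilbertPower N H) :
    ⟪kron M x, y⟫ = ⟪x, kron M.transpose y⟫ := by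
  simp only [PiLp.inner_apply, kron_apply, sum_inner, inner_sum, inner_smul_left, inner_smul_right,
    Matrix.transpose_apply, conj_trivial]
  exact Finset.sum_comm

theorem exists_eq_transpose_mul_self {M : Matrix (Fin N) (Fin N) ℝ} (hM : M.PosSemidef) :
    ∃ K : Matrix (Fin N) (Fin N) ℝ, M = K.transpose * K := by
  open scoped MatrixOrder Matrix.Norms.L2Operator in
  obtain ⟨K, hK⟩ := CStarAlgebra.nonneg_iff_eq_star_mul_self.1 hM.nonneg
  exact ⟨K, by rw [hK, Matrix.star_eq_conjTranspose, Matrix.conjTranspose_eq_transpose_of_trivial]⟩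

theorem inner_kron_nonneg {M : Matrix (Fin N) (Fin N) ℝ} (hM : M.PosSemidef)
    (x : HilbertPower N H) : 0 ≤ ⟪x, kron M x⟫ := by
  obtain ⟨K, rfl⟩ := exists_eq_transpose_mul_self hM
  rw [kron_mul, ← inner_kron_left]
  exact real_inner_self_nonneg

theorem matrixSpectralNorm_mul_transpose (T : Matrix (Fin N) (Fin N) ℝ) :
    matrixSpectralNorm (T * T.transpose) = matrixSpectralNorm T ^ 2 := by
  unfold matrixSpectralNorm
  rw [← Matrix.conjTranspose_eq_transpose_of_trivial, ← Matrix.star_eq_conjTranspose, map_mul,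
    map_star, sq]
  exact CStarRing.norm_self_mul_star (x := Matrix.toEuclideanCLM (n := Fin N) (𝕜 := ℝ) T)

theorem posSemidef_sub_transpose_mul_self (T : Matrix (Fin N) (Fin N) ℝ) :
    (matrixSpectralNorm (T * T.transpose) • (1 : Matrix (Fin N) (Fin N) ℝ)
      - T.transpose * T).PosSemidef := by
  refine .of_dotProduct_mulVec_nonneg ?_ fun v => ?_
  · rw [Matrix.IsHermitian, Matrix.conjTranspose_eq_transpose_of_trivial]
    simp [Matrix.transpose_mul]
  · have h := (Matrix.toEuclideanCLM (n := Fin N) (𝕜 := ℝ) T).le_opNorm (WithLp.toLp 2 v)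
    have h2 := pow_le_pow_left₀ (norm_nonneg _) h 2
    rw [mul_pow, Matrix.toEuclideanCLM_toLp] at h2
    simp only [EuclideanSpace.norm_sq_eq, Real.norm_eq_abs, sq_abs] at h2
    rw [matrixSpectralNorm_mul_transpose, Matrix.sub_mulVec, Matrix.smul_mulVec, Matrix.one_mulVec,
      dotProduct_sub, dotProduct_smul, ← Matrix.mulVec_mulVec, Matrix.dotProduct_mulVec,
      Matrix.vecMul_transpose, star_trivial, smul_eq_mul]
    simp only [dotProduct, ← sq]
    unfold matrixSpectralNorm
    linarith

theorem norm_kron_sq_le (T : Matrix (Fin N) (Fin N) ℝ) (x : HilbertPower N H) :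
    ‖kron T x‖ ^ 2 ≤ matrixSpectralNorm (T * T.transpose) * ‖x‖ ^ 2 := by
  have h := inner_kron_nonneg (posSemidef_sub_transpose_mul_self T) x
  rw [kron_sub, kron_smul, kron_one, kron_mul, inner_sub_right, ← inner_kron_left,
    inner_smul_right, real_inner_self_eq_norm_sq, real_inner_self_eq_norm_sq] at h
  linarith

theorem kron_diagonal_apply (d : Fin N → ℝ) (x : HilbertPower N H) (i : Fin N) :
    kron (Matrix.diagonal d) x i = d i • x i :=
  kron_stepMatrix_apply d x i

theorem sum_mul_norm_kron_transpose_sq_le {α : Fin N → ℝ} (hα : ∀ i, 0 ≤ α i)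
    {W K : Matrix (Fin N) (Fin N) ℝ} (hK : (1 / 2 : ℝ) • (1 - W) = K.transpose * K)
    (x : HilbertPower N H) :
    ∑ i, α i * ‖kron K.transpose x i‖ ^ 2
      ≤ matrixSpectralNorm (scaledLaplacian α W) * ‖x‖ ^ 2 := by
  have h := norm_kron_sq_le (Matrix.diagonal (fun i => √(α i)) * K.transpose) x
  rw [Matrix.transpose_mul, Matrix.diagonal_transpose, Matrix.transpose_transpose, Matrix.mul_assoc,
    ← Matrix.mul_assoc K.transpose, ← hK, ← Matrix.mul_assoc, kron_mul, PiLp.norm_sq_eq_of_L2] at h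
  simpa [kron_diagonal_apply, norm_smul, mul_pow, Real.sq_sqrt (hα _), scaledLaplacian] using h

end Kronecker

section Mixing

variable {N : ℕ} {H : Type*} [NormedAddCommGroup H] [InnerProductSpace ℝ H]
  {G : SimpleGraph (Fin N)} {W : Matrix (Fin N) (Fin N) ℝ}

theorem IsMixingMatrix.exists_factor (hW : IsMixingMatrix G W) :
    ∃ K : Matrix (Fin N) (Fin N) ℝ, (1 / 2 : ℝ) • (1 - W) = K.transpose * K :=
  exists_eq_transpose_mul_self (hW.le_one.smul (by norm_num))

theorem IsMixingMatrix.mulVec_eq_zero_iff (hW : IsMixingMatrix G W) {v : Fin N → ℝ} :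
    (1 - W).mulVec v = 0 ↔ ∃ c : ℝ, v = fun _ => c := by
  rw [← Matrix.toLin'_apply, ← LinearMap.mem_ker, hW.ker_eq, Submodule.mem_span_singleton]
  refine exists_congr fun c => ?_
  rw [eq_comm]
  have : (c • fun _ => (1 : ℝ) : Fin N → ℝ) = fun _ => c := by ext; simp
  rw [this]

variable {K : Matrix (Fin N) (Fin N) ℝ}

theorem kron_eq_zero_iff_of_factor (hK : (1 / 2 : ℝ) • (1 - W) = K.transpose * K)
    (x : HilbertPower N H) : kron K x = 0 ↔ kron (1 - W) x = 0 := by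
  have h : (1 / 2 : ℝ) • kron (1 - W) x = kron K.transpose (kron K x) := by
    rw [← kron_smul, hK, kron_mul]
  constructor
  · intro h0
    rw [h0, ← kronL_apply K.transpose, map_zero, smul_eq_zero] at h
    exact h.resolve_left (by norm_num)
  · intro h0
    rw [h0, smul_zero] at h
    have h1 : ⟪kron K x, kron K x⟫ = 0 := by rw [inner_kron_left, ← h, inner_zero_right]
    exact inner_self_eq_zero.1 h1

theorem IsMixingMatrix.kron_consensus (hW : IsMixingMatrix G W)
    (hK : (1 / 2 : ℝ) • (1 - W) = K.transpose * K) (p : H) : kron K (consensus N p) = 0 := by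
  rw [kron_eq_zero_iff_of_factor hK]
  have h := (hW.mulVec_eq_zero_iff (v := fun _ => 1)).2 ⟨1, rfl⟩
  ext i
  have hi := congrFun h i
  simp only [Matrix.mulVec, dotProduct, mul_one, Pi.zero_apply] at hi
  simp only [kron_apply, consensus, ← Finset.sum_smul, hi, zero_smul, PiLp.zero_apply]

theorem IsMixingMatrix.exists_eq_consensus (hW : IsMixingMatrix G W) [Nonempty (Fin N)]
    (hK : (1 / 2 : ℝ) • (1 - W) = K.transpose * K) {x : HilbertPower N H} (hx : kron K x = 0) :
    ∃ p : H, x = consensus N p := by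
  rw [kron_eq_zero_iff_of_factor hK] at hx
  obtain ⟨j⟩ := ‹Nonempty (Fin N)›
  refine ⟨x j, ?_⟩
  ext i
  refine ext_inner_right ℝ fun h => ?_
  have hv : (1 - W).mulVec (fun i => ⟪x i, h⟫) = 0 := by
    ext i
    have hi : ⟪kron (1 - W) x i, h⟫ = 0 := by rw [hx]; simp
    simpa only [kron_apply, sum_inner, inner_smul_left, conj_trivial, Matrix.mulVec, dotProduct,
      Pi.zero_apply] using hi
  obtain ⟨c, hc⟩ := hW.mulVec_eq_zero_iff.1 hv
  exact (congrFun hc i).trans (congrFun hc j).symm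

/-- The all-ones matrix. -/
def onesMatrix (N : ℕ) : Matrix (Fin N) (Fin N) ℝ := Matrix.of fun _ _ => 1

theorem kron_onesMatrix (x : HilbertPower N H) : kron (onesMatrix N) x = consensus N (∑ i, x i) := by
  ext i; simp [kron_apply, onesMatrix, consensus]

theorem IsMixingMatrix.onesMatrix_mul (hW : IsMixingMatrix G W) : onesMatrix N * (1 - W) = 0 := by
  have h := (hW.mulVec_eq_zero_iff (v := fun _ => 1)).2 ⟨1, rfl⟩
  ext i j
  have hj := congrFun h j
  have hs : (1 - W).transpose = 1 - W := by
    rw [Matrix.transpose_sub, Matrix.transpose_one, ← hW.symm]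
  simp only [Matrix.mulVec, dotProduct, mul_one, Pi.zero_apply] at hj
  simp only [Matrix.mul_apply, onesMatrix, Matrix.of_apply, one_mul, Matrix.zero_apply]
  rw [← hj]
  exact Finset.sum_congr rfl fun k _ => congrFun (congrFun hs j) k

theorem IsMixingMatrix.det_add_onesMatrix_ne_zero (hW : IsMixingMatrix G W) [Nonempty (Fin N)] :
    (1 - W + onesMatrix N).det ≠ 0 := by
  intro h0
  obtain ⟨v, hv, h⟩ := Matrix.exists_mulVec_eq_zero_iff.2 h0
  have hN : (N : ℝ) ≠ 0 := by
    have := Fintype.card_pos (α := Fin N)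
    simp only [Fintype.card_fin] at this
    positivity
  have hJ : (onesMatrix N).mulVec v = fun _ => ∑ i, v i := by
    ext i; simp [onesMatrix, Matrix.mulVec, dotProduct]
  have h1 : (onesMatrix N).mulVec ((onesMatrix N).mulVec v) = 0 := by
    have := congrArg (onesMatrix N).mulVec h
    rwa [Matrix.add_mulVec, Matrix.mulVec_add, Matrix.mulVec_mulVec, hW.onesMatrix_mul,
      Matrix.zero_mulVec, zero_add, Matrix.mulVec_zero] at this
  obtain ⟨j⟩ := ‹Nonempty (Fin N)›
  have h2 : ∑ i, v i = 0 := by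
    rw [hJ] at h1
    have := congrFun h1 j
    simpa [onesMatrix, Matrix.mulVec, dotProduct, hN] using this
  rw [Matrix.add_mulVec, hJ, h2] at h
  obtain ⟨c, rfl⟩ := hW.mulVec_eq_zero_iff.1 (by simpa [← Pi.zero_def] using h)
  have : c = 0 := by simpa [hN] using h2
  exact hv (by ext; simp [this])

theorem IsMixingMatrix.exists_kron_transpose_eq (hW : IsMixingMatrix G W) [Nonempty (Fin N)]
    (hK : (1 / 2 : ℝ) • (1 - W) = K.transpose * K) {x : HilbertPower N H} (hx : ∑ i, x i = 0) :
    ∃ e, kron K.transpose e = x := by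
  set S := 1 - W + onesMatrix N with hS
  have hinv : S * S⁻¹ = 1 := Matrix.mul_nonsing_inv _ (isUnit_iff_ne_zero.2
    hW.det_add_onesMatrix_ne_zero)
  set r := kron S⁻¹ x with hr
  have hSr : kron (1 - W) r + kron (onesMatrix N) r = x := by
    rw [← kron_add, ← hS, hr, ← kron_mul, hinv, kron_one]
  have hJ : kron (onesMatrix N) (kron (onesMatrix N) r) = 0 := by
    have h1 := congrArg (kron (onesMatrix N)) hSr
    rw [← kronL_apply, map_add, kronL_apply, kronL_apply, ← kron_mul, hW.onesMatrix_mul,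
      kron_onesMatrix x, hx] at h1
    have h2 : kron (0 : Matrix (Fin N) (Fin N) ℝ) r = 0 := by ext; simp [kron_apply]
    rw [h2, zero_add] at h1
    rw [h1]; rfl
  have hJr : kron (onesMatrix N) r = 0 := by
    have hsymm : (onesMatrix N).transpose = onesMatrix N := rfl
    refine inner_self_eq_zero (𝕜 := ℝ).1 ?_
    rw [inner_kron_left, hsymm, hJ, inner_zero_right]
  refine ⟨(2 : ℝ) • kron K r, ?_⟩
  rw [← kronL_apply, map_smul, kronL_apply, ← kron_mul, ← hK, kron_smul, smul_smul]
  rw [hJr, add_zero] at hSr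
  rw [hSr]; norm_num

end Mixing

section WeakLimits

open Filter

variable {ι E : Type*} [NormedAddCommGroup E] [InnerProductSpace ℝ E]

/-- Weak convergence along a filter, tested against inner products. -/
def WeakTendsto (l : Filter ι) (u : ι → E) (a : E) : Prop :=
  ∀ h, Tendsto (fun k => ⟪u k, h⟫) l (𝓝 ⟪a, h⟫)

theorem weaklyConverges_iff [CompleteSpace E] {u : ℕ → E} {a : E} :
    WeaklyConverges u a ↔ WeakTendsto atTop u a := by
  have hinj : Function.Injective (topDualPairing ℝ E).flip := by
    intro x y hxy
    refine ext_inner_left ℝ fun h => ?_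
    exact LinearMap.congr_fun hxy (InnerProductSpace.toDual ℝ E h)
  refine (WeakBilin.tendsto_iff_forall_eval_tendsto (topDualPairing ℝ E).flip hinj).trans ?_
  constructor
  · intro h w
    have := h (InnerProductSpace.toDual ℝ E w)
    simp only [real_inner_comm w]
    exact this
  · intro h φ
    obtain ⟨w, rfl⟩ := (InnerProductSpace.toDual ℝ E).surjective φ
    have := h w
    simp only [real_inner_comm w] at this
    exact this

theorem weaklyConverges_of_ultrafilter [CompleteSpace E] {u : ℕ → E} {a : E}
    (h : ∀ U : Ultrafilter ℕ, (U : Filter ℕ) ≤ atTop → WeakTendsto U u a) :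
    WeaklyConverges u a := by
  rw [weaklyConverges_iff]
  intro w
  rw [tendsto_iff_ultrafilter]
  exact fun U hU => h U hU w

variable {l : Filter ι} {u v : ι → E} {a b : E}

theorem WeakTendsto.unique [l.NeBot] (ha : WeakTendsto l u a) (hb : WeakTendsto l u b) : a = b :=
  ext_inner_right ℝ fun h => tendsto_nhds_unique (ha h) (hb h)

theorem WeakTendsto.add (ha : WeakTendsto l u a) (hb : WeakTendsto l v b) :
    WeakTendsto l (fun k => u k + v k) (a + b) := fun h => by
  simpa only [inner_add_left] using (ha h).add (hb h)

theorem WeakTendsto.sub (ha : WeakTendsto l u a) (hb : WeakTendsto l v b) :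
    WeakTendsto l (fun k => u k - v k) (a - b) := fun h => by
  simpa only [inner_sub_left] using (ha h).sub (hb h)

theorem _root_.Filter.Tendsto.weakTendsto (h : Tendsto u l (𝓝 a)) : WeakTendsto l u a :=
  fun _ => h.inner tendsto_const_nhds

theorem WeakTendsto.congr_sub (ha : WeakTendsto l u a) (h : Tendsto (fun k => v k - u k) l (𝓝 0)) :
    WeakTendsto l v a := by
  simpa using ha.add h.weakTendsto

theorem exists_weakTendsto_of_bounded [CompleteSpace E] (U : Ultrafilter ι) {u : ι → E} {C : ℝ}
    (hC : ∀ᶠ k in (U : Filter ι), ‖u k‖ ≤ C) : ∃ a, WeakTendsto (U : Filter ι) u a := by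
  have hlim : ∀ h, ∃ c, Tendsto (fun k => ⟪u k, h⟫) (U : Filter ι) (𝓝 c) := by
    intro h
    have hmem : Set.Icc (-(C * ‖h‖)) (C * ‖h‖) ∈ (U.map fun k => ⟪u k, h⟫) := by
      refine Ultrafilter.mem_map.2 ?_
      filter_upwards [hC] with k hk
      refine abs_le.1 ((abs_real_inner_le_norm _ _).trans ?_)
      gcongr
    obtain ⟨c, -, hc⟩ := isCompact_Icc.ultrafilter_le_nhds' _ hmem
    exact ⟨c, hc⟩
  choose φ hφ using hlim
  let Φ : E →ₗ[ℝ] ℝ :=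
    { toFun := φ
      map_add' := fun x y => tendsto_nhds_unique (hφ (x + y)) (by
        simpa only [inner_add_right] using (hφ x).add (hφ y))
      map_smul' := fun c x => tendsto_nhds_unique (hφ (c • x)) (by
        simpa only [inner_smul_right, RingHom.id_apply, smul_eq_mul] using (hφ x).const_mul c) }
  have hbound : ∀ h, ‖Φ h‖ ≤ C * ‖h‖ := by
    intro h
    refine le_of_tendsto (hφ h).norm ?_
    filter_upwards [hC] with k hk
    exact (norm_inner_le_norm _ _).trans (by gcongr)
  refine ⟨(InnerProductSpace.toDual ℝ E).symm (Φ.mkContinuous C hbound), fun h => ?_⟩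
  rw [InnerProductSpace.toDual_symm_apply]
  exact hφ h

end WeakLimits

section ProductWeakLimits

open Filter

variable {ι : Type*} {N : ℕ} {H : Type*} [NormedAddCommGroup H] [InnerProductSpace ℝ H]
  {l : Filter ι} {u : ι → HilbertPower N H} {a : HilbertPower N H}

theorem WeakTendsto.kron (ha : WeakTendsto l u a) (M : Matrix (Fin N) (Fin N) ℝ) :
    WeakTendsto l (fun k => kron M (u k)) (kron M a) := fun h => by
  simpa only [inner_kron_left] using ha (DistributedSplitting.kron M.transpose h)

theorem prodOp_mem_of_inner_nonneg {A : Fin N → H → Set H} (hA : ∀ i, IsMaximallyMonotone (A i))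
    {x u : HilbertPower N H} (h : ∀ w b, b ∈ prodOp A w → 0 ≤ ⟪x - w, u - b⟫) :
    u ∈ prodOp A x := by
  by_contra hu
  have hex : ∀ i, ∃ w b, b ∈ A i w ∧ ⟪x i - w, u i - b⟫ ≤ 0 ∧
      (u i ∉ A i (x i) → ⟪x i - w, u i - b⟫ < 0) := by
    intro i
    by_cases hi : u i ∈ A i (x i)
    · exact ⟨x i, u i, hi, by simp, fun h => (h hi).elim⟩
    · have := mt (hA i).mem_of_inner_nonneg hi
      push Not at this
      obtain ⟨w, b, hb, hlt⟩ := this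
      exact ⟨w, b, hb, hlt.le, fun _ => hlt⟩
  choose w b hb hle hlt using hex
  obtain ⟨j, hj⟩ : ∃ j, u j ∉ A j (x j) := by
    by_contra! hall
    exact hu hall
  have h0 := h (WithLp.toLp 2 w) (WithLp.toLp 2 b) hb
  rw [PiLp.inner_apply] at h0
  have h1 : ∑ i, ⟪x i - w i, u i - b i⟫ < ∑ _i : Fin N, (0 : ℝ) :=
    Finset.sum_lt_sum (fun i _ => hle i) ⟨j, Finset.mem_univ j, hlt j hj⟩
  rw [Finset.sum_const_zero] at h1
  exact absurd h0 (not_le.2 h1)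

end ProductWeakLimits

section Demiclosed

open Filter

variable {ι E : Type*} [NormedAddCommGroup E] [InnerProductSpace ℝ E]

/-- Minty's trick: a continuous operator is determined by the monotonicity inequality. -/
theorem eq_of_forall_inner_nonneg {B : E → E} (hB : Continuous B) {x b : E}
    (h : ∀ w, 0 ≤ ⟪x - w, b - B w⟫) : b = B x := by
  have key : ∀ t : ℝ, 0 < t → ⟪b - B x, b - B (x + t • (b - B x))⟫ ≤ 0 := by
    intro t ht
    have := h (x + t • (b - B x))
    rw [sub_add_cancel_left, inner_neg_left, inner_smul_left, conj_trivial] at this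
    by_contra! hc
    nlinarith [mul_pos ht hc]
  have hcont : Continuous fun t : ℝ => ⟪b - B x, b - B (x + t • (b - B x))⟫ := by fun_prop
  have hlim := (hcont.tendsto 0).mono_left (nhdsWithin_le_nhds (s := Set.Ioi 0))
  rw [zero_smul, add_zero] at hlim
  have h0 := le_of_tendsto hlim (eventually_nhdsWithin_of_forall key)
  rw [real_inner_self_eq_norm_sq] at h0
  have : ‖b - B x‖ = 0 := pow_eq_zero_iff two_ne_zero |>.1 (le_antisymm h0 (sq_nonneg _))
  exact sub_eq_zero.1 (norm_eq_zero.1 this)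

/-- Joint demiclosedness of a maximally monotone operator and a continuous monotone map: if the
duality products of the sum converge to the duality product of the weak limits, then each of the
limits lies in the corresponding graph. -/
theorem demiclosed_pair {A : E → Set E} {B : E → E} (hA : IsMonotone A)
    (hmax : ∀ x u, (∀ w b, b ∈ A w → 0 ≤ ⟪x - w, u - b⟫) → u ∈ A x)
    (hBcont : Continuous B) (hBmono : ∀ x y, 0 ≤ ⟪x - y, B x - B y⟫)
    {l : Filter ι} [l.NeBot] {x a : ι → E} {xs as bs : E}
    (ha : ∀ k, a k ∈ A (x k)) (hx : WeakTendsto l x xs) (has : WeakTendsto l a as)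
    (hbs : WeakTendsto l (fun k => B (x k)) bs)
    (hlim : Tendsto (fun k => ⟪x k, a k + B (x k)⟫) l (𝓝 ⟪xs, as + bs⟫)) :
    as ∈ A xs ∧ bs = B xs := by
  have key : ∀ w c w', c ∈ A w → 0 ≤ ⟪xs - w, as - c⟫ + ⟪xs - w', bs - B w'⟫ := by
    intro w c w' hc
    have hexp : ∀ p q r : E, ⟪p - w, q - c⟫ + ⟪p - w', r - B w'⟫
        = ⟪p, q + r⟫ - ⟪p, c⟫ - ⟪q, w⟫ + ⟪w, c⟫ - ⟪p, B w'⟫ - ⟪r, w'⟫ + ⟪w', B w'⟫ := by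
      intro p q r
      simp only [inner_sub_left, inner_sub_right, inner_add_right, real_inner_comm w q,
        real_inner_comm w' r]
      ring
    have ht : Tendsto (fun k => ⟪x k - w, a k - c⟫ + ⟪x k - w', B (x k) - B w'⟫) l
        (𝓝 (⟪xs - w, as - c⟫ + ⟪xs - w', bs - B w'⟫)) := by
      simp only [hexp]
      exact ((((((hlim.sub (hx c)).sub (has w)).add_const _).sub (hx (B w'))).sub
        (hbs w')).add_const _)
    exact ge_of_tendsto' ht fun k => add_nonneg (hA.inner_nonneg (ha k) hc) (hBmono _ _)
  have hmem : as ∈ A xs := hmax _ _ fun w c hc => by simpa using key w c xs hc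
  exact ⟨hmem, eq_of_forall_inner_nonneg hBcont fun w => by simpa using key xs as w hmem⟩

end Demiclosed

section Runs

variable {N : ℕ} {H : Type*} [NormedAddCommGroup H] [InnerProductSpace ℝ H]
  {A : Fin N → H → Set H} {B : Fin N → H → H} {α : Fin N → ℝ} {β : ℝ}
  {W K : Matrix (Fin N) (Fin N) ℝ} {y0 z0 : HilbertPower N H} {x y z v : ℕ → HilbertPower N H}

theorem exists_isRun [CompleteSpace H] (hα : ∀ i, 0 < α i) (hA : ∀ i, IsMaximallyMonotone (A i))
    (B : Fin N → H → H) (β : ℝ) (W : Matrix (Fin N) (Fin N) ℝ) (y0 z0 : HilbertPower N H) :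
    ∃ x y z v : ℕ → HilbertPower N H, IsRun A B α β W y0 z0 x y z v := by
  choose J hJ using exists_setResolvent_scaledOp_eq_singleton (H := H) hα hA
  let P := HilbertPower N H
  let y1 : P := (2 : ℝ) • J z0 - z0 - kron (stepMatrix α) (prodFun B y0)
  let vcur : P × P × P × P × P → P := fun s => (2 : ℝ) • prodFun B s.2.2.2.2 - prodFun B s.2.1
  let znext : P × P × P × P × P → P := fun s => s.2.2.2.1 - J s.2.2.2.1 +
    kron (modifiedMixing α β W)
      ((2 : ℝ) • J s.2.2.2.1 - s.1 - kron (stepMatrix α) (vcur s - s.2.2.1))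
  let step : P × P × P × P × P → P × P × P × P × P := fun s =>
    (J s.2.2.2.1, s.2.2.2.2, vcur s, znext s, J s.2.2.2.1 + znext s - s.2.2.2.1)
  let s : ℕ → P × P × P × P × P := fun k =>
    Nat.rec (J z0, y0, prodFun B y0, y1 + z0 - J z0, y1) (fun _ => step) k
  refine ⟨fun k => (s k).1, fun k => (s k).2.1,
    fun k => Nat.casesOn k z0 fun j => (s j).2.2.2.1, fun k => (s k).2.2.1, ?_⟩
  exact
    { y_zero := rfl
      z_zero := rfl
      v_zero := rfl
      x_zero := hJ z0
      y_one := rfl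
      z_one := rfl
      x_one := hJ _
      v_step := by rintro (_ | k) hk; exacts [absurd hk (by norm_num), rfl]
      z_step := by rintro (_ | k) hk; exacts [absurd hk (by norm_num), rfl]
      x_step := fun k _ => hJ _
      y_step := by rintro (_ | k) hk; exacts [absurd hk (by norm_num), rfl] }

theorem IsRun.setResolvent_eq (h : IsRun A B α β W y0 z0 x y z v) (k : ℕ) :
    setResolvent (scaledOp α A) (z k) = {x k} := by
  match k with
  | 0 => exact h.x_zero
  | 1 => exact h.x_one
  | k + 2 => exact h.x_step (k + 1) (by omega)

theorem IsRun.resolvent_mem (h : IsRun A B α β W y0 z0 x y z v) (hα : ∀ i, 0 < α i)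
    (hA : ∀ i, IsMonotone (A i)) (k : ℕ) (i : Fin N) :
    (α i)⁻¹ • (z k i - x k i) ∈ A i (x k i) :=
  (setResolvent_scaledOp_eq_singleton_iff hα hA).1 (h.setResolvent_eq k) i

theorem IsRun.y_succ (h : IsRun A B α β W y0 z0 x y z v) (k : ℕ) :
    y (k + 1) = x k + z (k + 1) - z k := by
  match k with
  | 0 => rw [zero_add, h.z_one]; abel
  | k + 1 => exact h.y_step (k + 1) (by omega)

theorem IsRun.y_succ_apply (hr : IsRun A B α β W y0 z0 x y z v) (k : ℕ)
    (i : Fin N) : y (k + 1) i = x k i + z (k + 1) i - z k i := by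
  rw [hr.y_succ]; rfl

theorem IsRun.v_succ (h : IsRun A B α β W y0 z0 x y z v) (k : ℕ) :
    v (k + 1) = (2 : ℝ) • prodFun B (y (k + 1)) - prodFun B (y k) :=
  h.v_step (k + 1) (by omega)

/-- The argument of the modified mixing matrix in the `k`-th iteration. -/
noncomputable def mixingInput (α : Fin N → ℝ) (x v : ℕ → HilbertPower N H) (k : ℕ) :
    HilbertPower N H :=
  (2 : ℝ) • x (k + 1) - x k - kronL (stepMatrix α) (v (k + 1) - v k)

/-- The dual sequence attached to a run and to a factor `K` of `(I - W) / 2`. -/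
noncomputable def dualSeq (α : Fin N → ℝ) (β : ℝ) (K : Matrix (Fin N) (Fin N) ℝ)
    (x v : ℕ → HilbertPower N H) : ℕ → HilbertPower N H
  | 0 => 0
  | k + 1 => dualSeq α β K x v k + β • kronL K (mixingInput α x v k)

/-- The matrix of the metric on the dual variable. -/
noncomputable def dualMetric (α : Fin N → ℝ) (β : ℝ) (K : Matrix (Fin N) (Fin N) ℝ) :
    Matrix (Fin N) (Fin N) ℝ :=
  β⁻¹ • 1 - K * stepMatrix α * K.transpose

theorem dualMetric_transpose : (dualMetric α β K).transpose = dualMetric α β K := by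
  simp [dualMetric, stepMatrix, Matrix.transpose_mul, Matrix.mul_assoc]

theorem kron_dualMetric (e : HilbertPower N H) :
    kron (dualMetric α β K) e
      = β⁻¹ • e - kronL K (kronL (stepMatrix α) (kronL K.transpose e)) := by
  simp only [dualMetric, kron_sub, kron_smul, kron_one, kron_mul, kronL_apply]

theorem inner_dualMetric_ge (hα : ∀ i, 0 ≤ α i)
    (hK : (1 / 2 : ℝ) • (1 - W) = K.transpose * K) (e : HilbertPower N H) :
    (β⁻¹ - matrixSpectralNorm (scaledLaplacian α W)) * ‖e‖ ^ 2
      ≤ ⟪kron (dualMetric α β K) e, e⟫ := by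
  have h := sum_mul_norm_kron_transpose_sq_le hα hK e
  have h1 : ⟪kronL K (kronL (stepMatrix α) (kronL K.transpose e)), e⟫
      = ∑ i, α i * ‖kron K.transpose e i‖ ^ 2 := by
    rw [kronL_apply, inner_kron_left, PiLp.inner_apply]
    refine Finset.sum_congr rfl fun i _ => ?_
    rw [kronL_apply, kron_stepMatrix_apply, inner_smul_left, kronL_apply,
      real_inner_self_eq_norm_sq, conj_trivial]
  rw [kron_dualMetric, inner_sub_left, inner_smul_left, h1, real_inner_self_eq_norm_sq,
    conj_trivial]
  linarith

theorem kron_modifiedMixing (hK : (1 / 2 : ℝ) • (1 - W) = K.transpose * K)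
    (s : HilbertPower N H) : kron (modifiedMixing α β W) s
      = s - kronL (stepMatrix α) (kronL K.transpose (β • kronL K s)) := by
  have h : (β / 2) • (stepMatrix α * (1 - W)) = β • (stepMatrix α * (K.transpose * K)) := by
    rw [← hK, Matrix.mul_smul, smul_smul]; congr 1; ring
  rw [modifiedMixing, h, kron_sub, kron_one, kron_smul, kron_mul, kron_mul]
  simp only [map_smul, kronL_apply]

theorem IsRun.z_succ (h : IsRun A B α β W y0 z0 x y z v)
    (hK : (1 / 2 : ℝ) • (1 - W) = K.transpose * K) (k : ℕ) :
    z (k + 1) = x k - kronL (stepMatrix α) (v k)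
      - kronL (stepMatrix α) (kronL K.transpose (dualSeq α β K x v k)) := by
  induction k with
  | zero =>
    rw [h.z_one, h.y_one, h.z_zero, dualSeq, map_zero, map_zero, kronL_apply]
    module
  | succ k ih =>
    have hs := h.z_step (k + 1) (by omega)
    rw [kron_modifiedMixing hK, Nat.add_sub_cancel, ← kronL_apply (stepMatrix α) (v _ - v _),
      ← mixingInput, ih] at hs
    rw [hs, dualSeq, map_add, map_add]
    nth_rewrite 1 [mixingInput]
    rw [map_sub]
    module

theorem IsRun.kron_y (h : IsRun A B α β W y0 z0 x y z v)
    (hK : (1 / 2 : ℝ) • (1 - W) = K.transpose * K) (hβ : β ≠ 0) (k : ℕ) :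
    kron K (y (k + 2))
      = kron (dualMetric α β K) (dualSeq α β K x v (k + 1) - dualSeq α β K x v k) := by
  have hy : y (k + 2) = kron (modifiedMixing α β W) (mixingInput α x v k) := by
    rw [h.y_succ (k + 1), h.z_step (k + 1) (by omega), Nat.add_sub_cancel, mixingInput,
      kronL_apply]
    abel
  have hd : dualSeq α β K x v (k + 1) - dualSeq α β K x v k
      = β • kronL K (mixingInput α x v k) := by rw [dualSeq, add_sub_cancel_left]
  rw [hd, hy, kron_dualMetric, inv_smul_smul₀ hβ, kron_modifiedMixing hK, ← kronL_apply K, map_sub]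

end Runs

section SaddlePoints

variable {N : ℕ} {H : Type*} [NormedAddCommGroup H] [InnerProductSpace ℝ H]
  {A : Fin N → H → Set H} {B : Fin N → H → H} {α : Fin N → ℝ}
  {G : SimpleGraph (Fin N)} {W K : Matrix (Fin N) (Fin N) ℝ} {xs zs es : HilbertPower N H}

/-- The stationary triples (primal, governing and dual variable) of the algorithm. -/
structure IsSaddle (A : Fin N → H → Set H) (B : Fin N → H → H) (α : Fin N → ℝ)
    (K : Matrix (Fin N) (Fin N) ℝ) (xs zs es : HilbertPower N H) : Prop where
  kron_eq_zero : kron K xs = 0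
  mem : ∀ i, (α i)⁻¹ • (zs i - xs i) ∈ A i (xs i)
  z_eq : ∀ i, zs i = xs i - α i • (B i (xs i) + kron K.transpose es i)

theorem sum_kron_transpose (hW : IsMixingMatrix G W)
    (hK : (1 / 2 : ℝ) • (1 - W) = K.transpose * K) (e : HilbertPower N H) :
    ∑ i, kron K.transpose e i = 0 := by
  refine ext_inner_left ℝ fun h => ?_
  have h1 : ⟪consensus N h, kron K.transpose e⟫ = 0 := by
    rw [← inner_kron_left, hW.kron_consensus hK, inner_zero_left]
  rw [inner_zero_right, inner_sum, ← h1, PiLp.inner_apply]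
  rfl

theorem IsSaddle.exists_solution (h : IsSaddle A B α K xs zs es) (hα : ∀ i, 0 < α i)
    (hW : IsMixingMatrix G W) [Nonempty (Fin N)]
    (hK : (1 / 2 : ℝ) • (1 - W) = K.transpose * K) :
    ∃ p, xs = consensus N p ∧ p ∈ inverse (sumOp A B) 0 := by
  obtain ⟨p, rfl⟩ := hW.exists_eq_consensus hK h.kron_eq_zero
  refine ⟨p, rfl, ?_⟩
  change (0 : H) ∈ ∑ i, (A i p + single (B i) p)
  refine (Set.mem_fintype_sum _ _).2 ⟨fun i => (α i)⁻¹ • (zs i - p) + B i p, fun i =>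
    Set.add_mem_add (h.mem i) rfl, ?_⟩
  rw [← neg_eq_zero, ← sum_kron_transpose hW hK es, ← Finset.sum_neg_distrib]
  refine Finset.sum_congr rfl fun i _ => ?_
  have hi : zs i = p - α i • (B i p + kron K.transpose es i) := h.z_eq i
  rw [hi, sub_sub_cancel_left, smul_neg, inv_smul_smul₀ (hα i).ne']
  abel

theorem exists_isSaddle (hsol : (inverse (sumOp A B) 0).Nonempty) (hα : ∀ i, 0 < α i)
    (hW : IsMixingMatrix G W) [Nonempty (Fin N)]
    (hK : (1 / 2 : ℝ) • (1 - W) = K.transpose * K) : ∃ xs zs es, IsSaddle A B α K xs zs es := by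
  obtain ⟨p, hp⟩ := hsol
  change (0 : H) ∈ ∑ i, (A i p + single (B i) p) at hp
  obtain ⟨g, hg, hsum⟩ := (Set.mem_fintype_sum _ _).1 hp
  choose a ha b hb hab using fun i => Set.mem_add.1 (hg i)
  obtain ⟨e, he⟩ := hW.exists_kron_transpose_eq hK (x := WithLp.toLp 2 fun i => -g i)
    (by simp [hsum])
  have hei : ∀ i, kron K.transpose e i = -g i := fun i => by rw [he]
  refine ⟨consensus N p, WithLp.toLp 2 fun i => p + α i • a i, e, hW.kron_consensus hK p,
    fun i => ?_, fun i => ?_⟩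
  · simpa [consensus, inv_smul_smul₀ (hα i).ne'] using ha i
  · have hbi : b i = B i p := hb i
    rw [hei, ← hab, hbi]
    simp only [consensus]
    module

end SaddlePoints

section Auxiliary

open Filter

theorem tendsto_of_lyapunov {R D : ℕ → ℝ} (hR : ∀ k, 0 ≤ R k) (hD : ∀ k, 0 ≤ D k)
    (h : ∀ k, R (k + 1) + D k ≤ R k) :
    (∃ c, Tendsto R atTop (𝓝 c)) ∧ Tendsto D atTop (𝓝 0) ∧ ∀ k, R k ≤ R 0 := by
  have hanti : Antitone R := antitone_nat_of_succ_le fun k => by linarith [hD k, h k]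
  have hc := tendsto_atTop_ciInf hanti ⟨0, by rintro _ ⟨k, rfl⟩; exact hR k⟩
  refine ⟨⟨_, hc⟩, ?_, fun k => hanti (Nat.zero_le k)⟩
  have h0 := hc.sub ((tendsto_add_atTop_iff_nat 1).2 hc)
  rw [sub_self] at h0
  exact squeeze_zero hD (fun k => by linarith [h k]) h0

theorem tendsto_of_mul_sq {E : Type*} [NormedAddCommGroup E] {c : ℝ} (hc : 0 < c) {f : ℕ → ℝ}
    {u : ℕ → E} (hf : Tendsto f atTop (𝓝 0)) (h : ∀ k, c * ‖u k‖ ^ 2 ≤ f k) :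
    Tendsto u atTop (𝓝 0) := by
  rw [tendsto_zero_iff_norm_tendsto_zero]
  have h1 : Tendsto (fun k => ‖u k‖ ^ 2) atTop (𝓝 0) :=
    squeeze_zero (fun k => sq_nonneg _) (fun k => (le_div_iff₀' hc).2 (h k))
      (by simpa using hf.div_const c)
  simpa using h1.sqrt

theorem bounded_of_mul_sq {E : Type*} [NormedAddCommGroup E] {c R : ℝ} (hc : 0 < c)
    {u : ℕ → E} {a : E} (h : ∀ k, c * ‖u k - a‖ ^ 2 ≤ R) : ∃ C, ∀ k, ‖u k‖ ≤ C := by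
  refine ⟨√(R / c) + ‖a‖, fun k => ?_⟩
  have h1 : ‖u k - a‖ ≤ √(R / c) := Real.le_sqrt_of_sq_le ((le_div_iff₀' hc).2 (h k))
  have h2 := norm_add_le (u k - a) a
  rw [sub_add_cancel] at h2
  linarith

variable {ι : Type*} {N : ℕ} {H : Type*} [NormedAddCommGroup H]

theorem hilbertPower_bounded {u : ι → HilbertPower N H} (h : ∀ i, ∃ C, ∀ k, ‖u k i‖ ≤ C) :
    ∃ C, ∀ k, ‖u k‖ ≤ C := by
  choose C hC using h
  refine ⟨√(∑ i, C i ^ 2), fun k => Real.le_sqrt_of_sq_le ?_⟩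
  rw [PiLp.norm_sq_eq_of_L2]
  exact Finset.sum_le_sum fun i _ => pow_le_pow_left₀ (norm_nonneg _) (hC i k) 2

theorem hilbertPower_tendsto_zero {l : Filter ι} {u : ι → HilbertPower N H}
    (h : ∀ i, Tendsto (fun k => u k i) l (𝓝 0)) : Tendsto u l (𝓝 0) :=
  ((PiLp.continuous_toLp 2 fun _ : Fin N => H).tendsto 0).comp (tendsto_pi_nhds.2 h)

theorem norm_apply_le (u : HilbertPower N H) (i : Fin N) : ‖u i‖ ≤ ‖u‖ := PiLp.norm_apply_le u i

theorem tendsto_prodFun_sub {B : Fin N → H → H} {L : Fin N → ℝ≥0}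
    (hB : ∀ i, LipschitzWith (L i) (B i)) {l : Filter ι} {u w : ι → HilbertPower N H}
    (h : Tendsto (fun k => u k - w k) l (𝓝 0)) :
    Tendsto (fun k => prodFun B (u k) - prodFun B (w k)) l (𝓝 0) := by
  refine hilbertPower_tendsto_zero fun i => squeeze_zero_norm (a := fun k => L i * ‖u k - w k‖)
    (fun k => ?_) (by simpa using h.norm.const_mul (L i : ℝ))
  refine ((hB i).norm_sub_le (u k i) (w k i)).trans ?_
  have := norm_apply_le (u k - w k) i
  rw [PiLp.sub_apply] at this
  gcongr

theorem continuous_prodFun {B : Fin N → H → H} {L : Fin N → ℝ≥0}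
    (hB : ∀ i, LipschitzWith (L i) (B i)) : Continuous (prodFun B) := by
  have := fun i => (hB i).continuous
  unfold prodFun
  fun_prop

variable [InnerProductSpace ℝ H]

theorem tendsto_inner_zero_of_bounded {E : Type*} [NormedAddCommGroup E] [InnerProductSpace ℝ E]
    {l : Filter ι} {u w : ι → E} {C : ℝ} (hC : ∀ k, ‖w k‖ ≤ C) (hu : Tendsto u l (𝓝 0)) :
    Tendsto (fun k => ⟪u k, w k⟫) l (𝓝 0) := by
  refine squeeze_zero_norm (a := fun k => ‖u k‖ * C) (fun k => ?_) (by simpa using hu.norm.mul_const C)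
  exact (norm_inner_le_norm _ _).trans (mul_le_mul_of_nonneg_left (hC k) (norm_nonneg _))

theorem inner_kron_sub_sub {S : Matrix (Fin N) (Fin N) ℝ} (hS : S.transpose = S)
    (u a b : HilbertPower N H) :
    ⟪kron S (u - a), u - a⟫ - ⟪kron S (u - b), u - b⟫
      = ⟪kron S a, a⟫ - ⟪kron S b, b⟫ - 2 * ⟪u, kron S (a - b)⟫ := by
  have hsymm : ∀ p q : HilbertPower N H, ⟪kron S p, q⟫ = ⟪kron S q, p⟫ := fun p q => by
    rw [inner_kron_left, hS, real_inner_comm]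
  have hsub : ∀ p q : HilbertPower N H, kron S (p - q) = kron S p - kron S q := fun p q =>
    (kronL S).map_sub p q
  simp only [hsub, inner_sub_left, inner_sub_right, hsymm _ u, real_inner_comm _ u]
  ring

theorem inner_kron_sub_polarization {S : Matrix (Fin N) (Fin N) ℝ} (hS : S.transpose = S)
    (a b c : HilbertPower N H) :
    2 * ⟪kron S (a - b), a - c⟫
      = ⟪kron S (a - c), a - c⟫ - ⟪kron S (b - c), b - c⟫ + ⟪kron S (a - b), a - b⟫ := by
  have hsymm : ∀ p q : HilbertPower N H, ⟪kron S p, q⟫ = ⟪kron S q, p⟫ := fun p q => by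
    rw [inner_kron_left, hS, real_inner_comm]
  have hsub : ∀ p q : HilbertPower N H, kron S (p - q) = kron S p - kron S q := fun p q =>
    (kronL S).map_sub p q
  simp only [hsub, inner_sub_left, inner_sub_right]
  linarith [hsymm a b, hsymm a c, hsymm b c]

theorem tendsto_inner_kron_sub_sub {S : Matrix (Fin N) (Fin N) ℝ} (hS : S.transpose = S)
    {l : Filter ι} {u : ι → HilbertPower N H} {c : HilbertPower N H} (hu : WeakTendsto l u c)
    (a b : HilbertPower N H) :
    Tendsto (fun k => ⟪kron S (u k - a), u k - a⟫ - ⟪kron S (u k - b), u k - b⟫) l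
      (𝓝 (⟪kron S (c - a), c - a⟫ - ⟪kron S (c - b), c - b⟫)) := by
  simp only [inner_kron_sub_sub hS]
  exact ((hu _).const_mul 2).const_sub _

end Auxiliary

section Lyapunov

open Filter

variable {N : ℕ} {H : Type*} [NormedAddCommGroup H] [InnerProductSpace ℝ H]
  {A : Fin N → H → Set H} {B : Fin N → H → H} {L : Fin N → ℝ≥0} {α : Fin N → ℝ} {β : ℝ}
  {W K : Matrix (Fin N) (Fin N) ℝ} {y0 z0 : HilbertPower N H} {x y z v : ℕ → HilbertPower N H}
  {xs zs es : HilbertPower N H}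

/-- The Lyapunov function of a run with respect to a saddle point. -/
noncomputable def lyapunov (B : Fin N → H → H) (L : Fin N → ℝ≥0) (α : Fin N → ℝ) (β : ℝ)
    (K : Matrix (Fin N) (Fin N) ℝ) (x y z v : ℕ → HilbertPower N H) (xs zs es : HilbertPower N H)
    (k : ℕ) : ℝ :=
  ∑ i, agentEnergy (α i) (L i) (B i) (xs i) (zs i) (z (k + 1) i) (z (k + 2) i) (y (k + 1) i)
      (y (k + 2) i) ‖z (k + 1) i - z k i‖
    + 1 / 2 * ⟪kron (dualMetric α β K) (dualSeq α β K x v (k + 1) - es),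
        dualSeq α β K x v (k + 1) - es⟫

/-- The squared distance to a saddle point in the metric of the algorithm. -/
noncomputable def metricDist (α : Fin N → ℝ) (β : ℝ) (K : Matrix (Fin N) (Fin N) ℝ)
    (x z v : ℕ → HilbertPower N H) (zs es : HilbertPower N H) (k : ℕ) : ℝ :=
  ⟪kron (stepMatrix fun i => (α i)⁻¹) (z (k + 2) - zs), z (k + 2) - zs⟫
    + ⟪kron (dualMetric α β K) (dualSeq α β K x v (k + 1) - es), dualSeq α β K x v (k + 1) - es⟫

theorem inner_kron_stepMatrix (c : Fin N → ℝ) (u : HilbertPower N H) :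
    ⟪kron (stepMatrix c) u, u⟫ = ∑ i, c i * ‖u i‖ ^ 2 := by
  rw [PiLp.inner_apply]
  refine Finset.sum_congr rfl fun i _ => ?_
  rw [kron_stepMatrix_apply, inner_smul_left, real_inner_self_eq_norm_sq, conj_trivial]

/-- The standing hypotheses on the data of the algorithm. -/
structure IsAdmissible (A : Fin N → H → Set H) (B : Fin N → H → H) (L : Fin N → ℝ≥0)
    (α : Fin N → ℝ) (β : ℝ) (W K : Matrix (Fin N) (Fin N) ℝ) : Prop where
  maximal : ∀ i, IsMaximallyMonotone (A i)
  mono : ∀ i, IsMonotone (single (B i))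
  lip : ∀ i, LipschitzWith (L i) (B i)
  α_pos : ∀ i, 0 < α i
  α_lt : ∀ i, α i * (8 * (L i : ℝ)) < 1
  β_pos : 0 < β
  β_lt : β * matrixSpectralNorm (scaledLaplacian α W) < 1
  factor : (1 / 2 : ℝ) • (1 - W) = K.transpose * K

namespace IsAdmissible

theorem inner_B_nonneg (h : IsAdmissible A B L α β W K) (i : Fin N) (p q : H) :
    0 ≤ ⟪p - q, B i p - B i q⟫ :=
  (h.mono i).inner_nonneg (u := B i p) (v := B i q) rfl rfl

theorem norm_B_sub_le (h : IsAdmissible A B L α β W K) (i : Fin N) (p q : H) :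
    ‖B i p - B i q‖ ≤ L i * ‖p - q‖ :=
  (h.lip i).norm_sub_le p q

theorem step_gap_pos (h : IsAdmissible A B L α β W K) (i : Fin N) :
    0 < 1 / 2 * (α i)⁻¹ - 4 * (L i : ℝ) := by
  have h1 := h.α_lt i
  have h2 : 8 * (L i : ℝ) < (α i)⁻¹ := by
    have := mul_lt_mul_of_pos_left h1 (inv_pos.2 (h.α_pos i))
    rwa [inv_mul_cancel_left₀ (h.α_pos i).ne', mul_one] at this
  linarith

theorem dual_gap_pos (h : IsAdmissible A B L α β W K) :
    0 < β⁻¹ - matrixSpectralNorm (scaledLaplacian α W) := by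
  have := mul_lt_mul_of_pos_left h.β_lt (inv_pos.2 h.β_pos)
  rw [inv_mul_cancel_left₀ h.β_pos.ne', mul_one] at this
  linarith

theorem dualMetric_nonneg (h : IsAdmissible A B L α β W K) (e : HilbertPower N H) :
    0 ≤ ⟪kron (dualMetric α β K) e, e⟫ :=
  (mul_nonneg h.dual_gap_pos.le (sq_nonneg _)).trans
    (inner_dualMetric_ge (fun i => (h.α_pos i).le) h.factor e)

theorem resolvent_inner_nonneg (h : IsAdmissible A B L α β W K)
    (hr : IsRun A B α β W y0 z0 x y z v) (j k : ℕ) (i : Fin N) :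
    0 ≤ ⟪x j i - x k i, (z j i - x j i) - (z k i - x k i)⟫ :=
  (h.maximal i).1.resolvent_inner_nonneg (h.α_pos i)
    (hr.resolvent_mem h.α_pos (fun i => (h.maximal i).1) j i)
    (hr.resolvent_mem h.α_pos (fun i => (h.maximal i).1) k i)

theorem saddle_inner_nonneg (h : IsAdmissible A B L α β W K)
    (hr : IsRun A B α β W y0 z0 x y z v) (hs : IsSaddle A B α K xs zs es) (k : ℕ) (i : Fin N) :
    0 ≤ ⟪x k i - xs i, (z k i - x k i) - (zs i - xs i)⟫ :=
  (h.maximal i).1.resolvent_inner_nonneg (h.α_pos i)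
    (hr.resolvent_mem h.α_pos (fun i => (h.maximal i).1) k i) (hs.mem i)

theorem lyapunov_step (h : IsAdmissible A B L α β W K) (hr : IsRun A B α β W y0 z0 x y z v)
    (hs : IsSaddle A B α K xs zs es) (k : ℕ) :
    lyapunov B L α β K x y z v xs zs es (k + 1)
      + (∑ i, (1 / 2 * (α i)⁻¹ - 4 * (L i : ℝ)) * ‖z (k + 3) i - z (k + 2) i‖ ^ 2
        + 1 / 2 * ⟪kron (dualMetric α β K)
            (dualSeq α β K x v (k + 2) - dualSeq α β K x v (k + 1)),
            dualSeq α β K x v (k + 2) - dualSeq α β K x v (k + 1)⟫)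
      ≤ lyapunov B L α β K x y z v xs zs es k := by
  have hz : ∀ i, z (k + 3) i = x (k + 2) i - α i • ((2 : ℝ) • B i (y (k + 2) i) - B i (y (k + 1) i)
      + kron K.transpose (dualSeq α β K x v (k + 2)) i) := by
    intro i
    rw [hr.z_succ h.factor (k + 2), hr.v_succ (k + 1)]
    simp only [kronL_apply, PiLp.sub_apply, kron_stepMatrix_apply, PiLp.smul_apply, prodFun]
    module
  have hstep := Finset.sum_le_sum fun i (_ : i ∈ Finset.univ) =>
    agentEnergy_step (h.α_pos i) (L i).coe_nonneg (h.inner_B_nonneg i) (h.norm_B_sub_le i)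
      (hr.y_succ_apply k i) (hr.y_succ_apply (k + 1) i) (hr.y_succ_apply (k + 2) i) (hz i)
      (hs.z_eq i) (h.saddle_inner_nonneg hr hs (k + 2) i)
      (h.resolvent_inner_nonneg hr (k + 2) (k + 1) i) (h.resolvent_inner_nonneg hr (k + 1) k i)
  simp only [Finset.sum_add_distrib] at hstep
  have hdual : ∑ i, ⟪y (k + 3) i - xs i, kron K.transpose (dualSeq α β K x v (k + 2)) i
      - kron K.transpose es i⟫
      = ⟪kron (dualMetric α β K) (dualSeq α β K x v (k + 2) - dualSeq α β K x v (k + 1)),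
        dualSeq α β K x v (k + 2) - es⟫ := by
    rw [← hr.kron_y h.factor h.β_pos.ne' (k + 1)]
    have h1 : kron K (y (k + 3)) = kron K (y (k + 3) - xs) := by
      rw [← kronL_apply, ← kronL_apply, map_sub, kronL_apply K xs, hs.kron_eq_zero, sub_zero]
    rw [h1, inner_kron_left, PiLp.inner_apply]
    refine Finset.sum_congr rfl fun i _ => ?_
    rw [← kronL_apply K.transpose (_ - _), map_sub]
    rfl
  rw [hdual] at hstep
  have hpol := inner_kron_sub_polarization (dualMetric_transpose (α := α) (β := β) (K := K))
    (dualSeq α β K x v (k + 2)) (dualSeq α β K x v (k + 1)) es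
  unfold lyapunov
  simp only [add_assoc, Nat.reduceAdd] at hstep ⊢
  linarith

theorem le_lyapunov (h : IsAdmissible A B L α β W K) (hr : IsRun A B α β W y0 z0 x y z v)
    (hs : IsSaddle A B α K xs zs es) (k : ℕ) :
    ∑ i, (1 / 2 * (α i)⁻¹ - 3 * (L i : ℝ)) * ‖z (k + 2) i - zs i‖ ^ 2
      + 1 / 2 * ((β⁻¹ - matrixSpectralNorm (scaledLaplacian α W))
        * ‖dualSeq α β K x v (k + 1) - es‖ ^ 2)
      ≤ lyapunov B L α β K x y z v xs zs es k := by
  unfold lyapunov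
  have h1 := inner_dualMetric_ge (β := β) (fun i => (h.α_pos i).le) h.factor
    (dualSeq α β K x v (k + 1) - es)
  refine add_le_add (Finset.sum_le_sum fun i _ => ?_) (by linarith)
  exact le_agentEnergy (L i).coe_nonneg (h.norm_B_sub_le i) (hr.y_succ_apply k i)
    (hr.y_succ_apply (k + 1) i) (h.saddle_inner_nonneg hr hs (k + 1) i)
    (h.resolvent_inner_nonneg hr (k + 1) k i)

theorem step_terms_nonneg (h : IsAdmissible A B L α β W K) (u w : HilbertPower N H) :
    0 ≤ ∑ i, (1 / 2 * (α i)⁻¹ - 4 * (L i : ℝ)) * ‖u i‖ ^ 2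
      ∧ 0 ≤ 1 / 2 * ⟪kron (dualMetric α β K) w, w⟫ :=
  ⟨Finset.sum_nonneg fun i _ => mul_nonneg (h.step_gap_pos i).le (sq_nonneg _),
    mul_nonneg (by norm_num) (h.dualMetric_nonneg w)⟩

theorem energy_gap_pos (h : IsAdmissible A B L α β W K) (i : Fin N) :
    0 < 1 / 2 * (α i)⁻¹ - 3 * (L i : ℝ) := by
  linarith [h.step_gap_pos i, (L i).coe_nonneg]

theorem lyapunov_nonneg (h : IsAdmissible A B L α β W K) (hr : IsRun A B α β W y0 z0 x y z v)
    (hs : IsSaddle A B α K xs zs es) (k : ℕ) : 0 ≤ lyapunov B L α β K x y z v xs zs es k := by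
  refine le_trans (add_nonneg (Finset.sum_nonneg fun i _ => ?_) ?_) (h.le_lyapunov hr hs k)
  · exact mul_nonneg (h.energy_gap_pos i).le (sq_nonneg _)
  · exact mul_nonneg (by norm_num) (mul_nonneg h.dual_gap_pos.le (sq_nonneg _))

theorem lyapunov_tendsto (h : IsAdmissible A B L α β W K) (hr : IsRun A B α β W y0 z0 x y z v)
    (hs : IsSaddle A B α K xs zs es) :
    (∃ c, Tendsto (lyapunov B L α β K x y z v xs zs es) atTop (𝓝 c)) ∧
    Tendsto (fun k => ∑ i, (1 / 2 * (α i)⁻¹ - 4 * (L i : ℝ)) * ‖z (k + 3) i - z (k + 2) i‖ ^ 2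
      + 1 / 2 * ⟪kron (dualMetric α β K)
          (dualSeq α β K x v (k + 2) - dualSeq α β K x v (k + 1)),
          dualSeq α β K x v (k + 2) - dualSeq α β K x v (k + 1)⟫) atTop (𝓝 0) ∧
    ∀ k, lyapunov B L α β K x y z v xs zs es k ≤ lyapunov B L α β K x y z v xs zs es 0 :=
  tendsto_of_lyapunov (h.lyapunov_nonneg hr hs)
    (fun k => add_nonneg (h.step_terms_nonneg (z (k + 3) - z (k + 2)) 0).1
      (h.step_terms_nonneg 0 _).2) (h.lyapunov_step hr hs)

theorem tendsto_z_sub (h : IsAdmissible A B L α β W K) (hr : IsRun A B α β W y0 z0 x y z v)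
    (hs : IsSaddle A B α K xs zs es) : Tendsto (fun k => z (k + 1) - z k) atTop (𝓝 0) := by
  refine (tendsto_add_atTop_iff_nat 2).1 (hilbertPower_tendsto_zero fun i => ?_)
  refine tendsto_of_mul_sq (h.step_gap_pos i) (h.lyapunov_tendsto hr hs).2.1 fun k => ?_
  refine le_trans ?_ (le_add_of_nonneg_right (h.step_terms_nonneg 0 _).2)
  exact Finset.single_le_sum (f := fun i => (1 / 2 * (α i)⁻¹ - 4 * (L i : ℝ))
    * ‖z (k + 3) i - z (k + 2) i‖ ^ 2)
    (fun i _ => mul_nonneg (h.step_gap_pos i).le (sq_nonneg _)) (Finset.mem_univ i)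

theorem tendsto_dualSeq_sub (h : IsAdmissible A B L α β W K)
    (hr : IsRun A B α β W y0 z0 x y z v) (hs : IsSaddle A B α K xs zs es) :
    Tendsto (fun k => dualSeq α β K x v (k + 1) - dualSeq α β K x v k) atTop (𝓝 0) := by
  refine (tendsto_add_atTop_iff_nat 1).1 ?_
  refine tendsto_of_mul_sq (half_pos h.dual_gap_pos) (h.lyapunov_tendsto hr hs).2.1 fun k => ?_
  refine le_trans ?_ (le_add_of_nonneg_left (h.step_terms_nonneg (z (k + 3) - z (k + 2)) 0).1)
  have := inner_dualMetric_ge (β := β) (fun i => (h.α_pos i).le) h.factor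
    (dualSeq α β K x v (k + 2) - dualSeq α β K x v (k + 1))
  linarith

theorem z_bounded (h : IsAdmissible A B L α β W K) (hr : IsRun A B α β W y0 z0 x y z v)
    (hs : IsSaddle A B α K xs zs es) : ∃ C, ∀ k, ‖z (k + 2)‖ ≤ C := by
  refine hilbertPower_bounded fun i => bounded_of_mul_sq (h.energy_gap_pos i) (a := zs i)
    (R := lyapunov B L α β K x y z v xs zs es 0) fun k => ?_
  refine le_trans ?_ ((h.le_lyapunov hr hs k).trans ((h.lyapunov_tendsto hr hs).2.2 k))
  refine le_trans ?_ (le_add_of_nonneg_right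
    (mul_nonneg (by norm_num) (mul_nonneg h.dual_gap_pos.le (sq_nonneg _))))
  exact Finset.single_le_sum (f := fun i => (1 / 2 * (α i)⁻¹ - 3 * (L i : ℝ))
    * ‖z (k + 2) i - zs i‖ ^ 2)
    (fun i _ => mul_nonneg (h.energy_gap_pos i).le (sq_nonneg _)) (Finset.mem_univ i)

theorem dualSeq_bounded (h : IsAdmissible A B L α β W K) (hr : IsRun A B α β W y0 z0 x y z v)
    (hs : IsSaddle A B α K xs zs es) : ∃ C, ∀ k, ‖dualSeq α β K x v (k + 1)‖ ≤ C := by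
  refine bounded_of_mul_sq (half_pos h.dual_gap_pos) (a := es)
    (R := lyapunov B L α β K x y z v xs zs es 0) fun k => ?_
  refine le_trans ?_ ((h.le_lyapunov hr hs k).trans ((h.lyapunov_tendsto hr hs).2.2 k))
  have : 0 ≤ ∑ i, (1 / 2 * (α i)⁻¹ - 3 * (L i : ℝ)) * ‖z (k + 2) i - zs i‖ ^ 2 :=
    Finset.sum_nonneg fun i _ => mul_nonneg (h.energy_gap_pos i).le (sq_nonneg _)
  linarith

theorem x_bounded (h : IsAdmissible A B L α β W K) (hr : IsRun A B α β W y0 z0 x y z v)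
    (hs : IsSaddle A B α K xs zs es) : ∃ C, ∀ k, ‖x (k + 2)‖ ≤ C := by
  obtain ⟨C, hC⟩ := h.z_bounded hr hs
  refine hilbertPower_bounded fun i => ⟨C + ‖zs i‖ + ‖xs i‖, fun k => ?_⟩
  have h1 := h.saddle_inner_nonneg hr hs (k + 2) i
  rw [sub_sub_sub_comm] at h1
  have h2 := (norm_le_of_inner_sub_nonneg h1).1
  have h3 := norm_sub_le (z (k + 2) i) (zs i)
  have h4 := norm_add_le (x (k + 2) i - xs i) (xs i)
  rw [sub_add_cancel] at h4
  linarith [norm_apply_le (z (k + 2)) i, hC k]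

theorem tendsto_y_sub (h : IsAdmissible A B L α β W K) (hr : IsRun A B α β W y0 z0 x y z v)
    (hs : IsSaddle A B α K xs zs es) : Tendsto (fun k => y (k + 1) - y k) atTop (𝓝 0) := by
  refine (tendsto_add_atTop_iff_nat 1).1 ?_
  have hz := (h.tendsto_z_sub hr hs).norm
  have hz' := (tendsto_add_atTop_iff_nat 1).2 hz
  refine hilbertPower_tendsto_zero fun i => squeeze_zero_norm
    (a := fun k => ‖z (k + 2) - z (k + 1)‖ + ‖z (k + 1) - z k‖) (fun k => ?_)
    (by simpa using hz'.add hz)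
  have h1 := norm_forward_sub_le (z₃ := z (k + 2) i) (h.resolvent_inner_nonneg hr (k + 1) k i)
  rw [← hr.y_succ_apply, ← hr.y_succ_apply] at h1
  exact h1.trans (add_le_add (norm_apply_le (z (k + 2) - z (k + 1)) i)
    (norm_apply_le (z (k + 1) - z k) i))

theorem tendsto_x_sub_y (h : IsAdmissible A B L α β W K) (hr : IsRun A B α β W y0 z0 x y z v)
    (hs : IsSaddle A B α K xs zs es) : Tendsto (fun k => x k - y k) atTop (𝓝 0) := by
  have h1 := (h.tendsto_y_sub hr hs).sub (h.tendsto_z_sub hr hs)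
  rw [sub_zero] at h1
  refine h1.congr fun k => ?_
  rw [hr.y_succ]
  abel

theorem tendsto_kron_x (h : IsAdmissible A B L α β W K) (hr : IsRun A B α β W y0 z0 x y z v)
    (hs : IsSaddle A B α K xs zs es) : Tendsto (fun k => kron K (x k)) atTop (𝓝 0) := by
  have h1 : Tendsto (fun k => kron K (y k)) atTop (𝓝 0) := by
    refine (tendsto_add_atTop_iff_nat 2).1 ?_
    simp only [hr.kron_y h.factor h.β_pos.ne']
    have := ((kronL (dualMetric α β K)).continuous.tendsto 0).comp (h.tendsto_dualSeq_sub hr hs)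
    rwa [map_zero] at this
  have h2 := ((kronL K).continuous.tendsto 0).comp (h.tendsto_x_sub_y hr hs)
  rw [map_zero] at h2
  have h3 := h2.add h1
  rw [add_zero] at h3
  refine h3.congr fun k => ?_
  rw [Function.comp_apply, map_sub, kronL_apply, kronL_apply, sub_add_cancel]

theorem metricDist_tendsto (h : IsAdmissible A B L α β W K) (hr : IsRun A B α β W y0 z0 x y z v)
    (hs : IsSaddle A B α K xs zs es) : ∃ c, Tendsto (metricDist α β K x z v zs es) atTop (𝓝 c) := by
  obtain ⟨⟨c, hc⟩, -, -⟩ := h.lyapunov_tendsto hr hs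
  obtain ⟨C, hC⟩ := h.z_bounded hr hs
  have hz := h.tendsto_z_sub hr hs
  have hδ : ∀ i, Tendsto (fun k => ‖z (k + 1) i - z k i‖) atTop (𝓝 0) := fun i =>
    squeeze_zero (fun k => norm_nonneg _) (fun k => norm_apply_le (z (k + 1) - z k) i)
      (by simpa using hz.norm)
  have hδ' : ∀ i, Tendsto (fun k => ‖z (k + 2) i - z (k + 1) i‖) atTop (𝓝 0) := fun i =>
    (tendsto_add_atTop_iff_nat 1).2 (hδ i)
  have hcross : ∀ i, Tendsto (fun k => ⟪y (k + 2) i - xs i, B i (y (k + 2) i) - B i (y (k + 1) i)⟫)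
      atTop (𝓝 0) := by
    intro i
    refine squeeze_zero_norm (a := fun k => L i * ((2 * (C + ‖zs i‖) + ‖z (k + 2) i - z (k + 1) i‖)
      * (‖z (k + 2) i - z (k + 1) i‖ + ‖z (k + 1) i - z k i‖))) (fun k => ?_) ?_
    · refine (abs_inner_forward_le (L i).coe_nonneg (h.norm_B_sub_le i) (hr.y_succ_apply k i)
        (hr.y_succ_apply (k + 1) i) (h.saddle_inner_nonneg hr hs (k + 1) i)
        (h.resolvent_inner_nonneg hr (k + 1) k i)).trans ?_
      have h3 := norm_sub_le (z (k + 2) i) (zs i)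
      have h4 := norm_apply_le (z (k + 2)) i
      have h5 := hC k
      have h6 : (0 : ℝ) ≤ L i := (L i).coe_nonneg
      gcongr
      linarith
    · simpa using ((((hδ' i).const_add (2 * (C + ‖zs i‖))).mul ((hδ' i).add (hδ i))).const_mul
        (L i : ℝ))
  have herr : Tendsto (fun k => ∑ i, (⟪y (k + 2) i - xs i, B i (y (k + 2) i) - B i (y (k + 1) i)⟫
      - 3 * L i * ‖z (k + 2) i - z (k + 1) i‖ ^ 2 - L i * ‖z (k + 1) i - z k i‖ ^ 2))
      atTop (𝓝 0) := by
    have := tendsto_finsetSum Finset.univ fun i (_ : i ∈ Finset.univ) =>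
      ((hcross i).sub (((hδ' i).pow 2).const_mul (3 * (L i : ℝ)))).sub
        (((hδ i).pow 2).const_mul (L i : ℝ))
    simpa using this
  refine ⟨2 * (c + 0), ((hc.add herr).const_mul 2).congr fun k => ?_⟩
  rw [metricDist, inner_kron_stepMatrix, lyapunov, add_right_comm, ← Finset.sum_add_distrib, mul_add,
    Finset.mul_sum, ← mul_assoc]
  congr 1
  · refine Finset.sum_congr rfl fun i _ => ?_
    rw [agentEnergy, PiLp.sub_apply]
    ring
  · norm_num

end IsAdmissible

end Lyapunov

section Convergence

open Filter

variable {N : ℕ} {H : Type*} [NormedAddCommGroup H] [InnerProductSpace ℝ H]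
  {A : Fin N → H → Set H} {B : Fin N → H → H} {L : Fin N → ℝ≥0} {α : Fin N → ℝ} {β : ℝ}
  {W K : Matrix (Fin N) (Fin N) ℝ} {y0 z0 : HilbertPower N H} {x y z v : ℕ → HilbertPower N H}
  {xs zs es : HilbertPower N H}

theorem eventually_norm_le_of_shift {E : Type*} [NormedAddCommGroup E] {u : ℕ → E} {m : ℕ}
    (h : ∃ C, ∀ k, ‖u (k + m)‖ ≤ C) : ∃ C, ∀ᶠ k in atTop, ‖u k‖ ≤ C := by
  obtain ⟨C, hC⟩ := h
  refine ⟨C, eventually_atTop.2 ⟨m, fun k hk => ?_⟩⟩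
  rw [← Nat.sub_add_cancel hk]
  exact hC _

namespace IsAdmissible

theorem tendsto_residual (h : IsAdmissible A B L α β W K) (hr : IsRun A B α β W y0 z0 x y z v)
    (hs : IsSaddle A B α K xs zs es) :
    Tendsto (fun k => kron (stepMatrix fun i => (α i)⁻¹) (z k - x k) + prodFun B (x k)
      + kron K.transpose (dualSeq α β K x v k)) atTop (𝓝 0) := by
  have hz := h.tendsto_z_sub hr hs
  have hy := h.tendsto_y_sub hr hs
  have h1 : Tendsto (fun k => kronL (stepMatrix fun i => (α i)⁻¹) (z (k + 1) - z k)) atTop (𝓝 0) := by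
    have := ((kronL (stepMatrix fun i => (α i)⁻¹)).continuous.tendsto 0).comp hz
    rwa [map_zero] at this
  have h2 := tendsto_prodFun_sub h.lip (h.tendsto_x_sub_y hr hs)
  have h3 := tendsto_prodFun_sub h.lip hy
  refine (tendsto_add_atTop_iff_nat 1).1 ?_
  have h4 := ((((tendsto_add_atTop_iff_nat 1).2 h2).sub h3).sub ((tendsto_add_atTop_iff_nat 1).2 h1))
  simp only [sub_zero] at h4
  refine h4.congr fun k => ?_
  ext i
  have hzi : z (k + 2) i = x (k + 1) i - α i • (((2 : ℝ) • B i (y (k + 1) i) - B i (y k i))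
      + kron K.transpose (dualSeq α β K x v (k + 1)) i) := by
    rw [hr.z_succ h.factor (k + 1), hr.v_succ k]
    simp only [kronL_apply, PiLp.sub_apply, kron_stepMatrix_apply, PiLp.smul_apply, prodFun]
    module
  simp only [kronL_apply, PiLp.sub_apply, PiLp.add_apply, kron_stepMatrix_apply, prodFun]
  rw [show k + 1 + 1 = k + 2 from rfl, hzi]
  have hc : ∀ w : H, (α i)⁻¹ • (x (k + 1) i - α i • w - z (k + 1) i)
      = -((α i)⁻¹ • (z (k + 1) i - x (k + 1) i)) - w := by
    intro w
    rw [sub_right_comm, smul_sub, inv_smul_smul₀ (h.α_pos i).ne', ← smul_neg, neg_sub]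
  rw [hc]
  module

/-- Along any ultrafilter the run converges weakly to a saddle point. -/
theorem exists_weak_limit_isSaddle [CompleteSpace H] (h : IsAdmissible A B L α β W K)
    (hr : IsRun A B α β W y0 z0 x y z v) (hs : IsSaddle A B α K xs zs es) (U : Ultrafilter ℕ)
    (hU : (U : Filter ℕ) ≤ atTop) :
    ∃ xu zu eu, IsSaddle A B α K xu zu eu ∧ WeakTendsto (U : Filter ℕ) x xu ∧
      WeakTendsto (U : Filter ℕ) z zu ∧ WeakTendsto (U : Filter ℕ) (dualSeq α β K x v) eu := by
  obtain ⟨Cx, hCx⟩ := eventually_norm_le_of_shift (h.x_bounded hr hs)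
  obtain ⟨Cz, hCz⟩ := eventually_norm_le_of_shift (h.z_bounded hr hs)
  obtain ⟨Ce, hCe⟩ := eventually_norm_le_of_shift (h.dualSeq_bounded hr hs)
  obtain ⟨xu, hxu⟩ := exists_weakTendsto_of_bounded U (hU hCx)
  obtain ⟨zu, hzu⟩ := exists_weakTendsto_of_bounded U (hU hCz)
  obtain ⟨eu, heu⟩ := exists_weakTendsto_of_bounded U (hU hCe)
  set Λi := stepMatrix fun i => (α i)⁻¹ with hΛi
  have hres := (h.tendsto_residual hr hs).mono_left hU
  have hau : WeakTendsto (U : Filter ℕ) (fun k => kron Λi (z k - x k)) (kron Λi (zu - xu)) :=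
    (hzu.sub hxu).kron Λi
  have hqu := heu.kron K.transpose
  have hbu : WeakTendsto (U : Filter ℕ) (fun k => prodFun B (x k))
      (-(kron Λi (zu - xu)) - kron K.transpose eu) := by
    have := (hres.weakTendsto.sub hau).sub hqu
    rw [zero_sub] at this
    refine this.congr_sub (Tendsto.congr (f₁ := fun _ => 0) (fun k => ?_) tendsto_const_nhds)
    abel
  have hKx := (h.tendsto_kron_x hr hs).mono_left hU
  have hKxu : kron K xu = 0 := (hxu.kron K).unique hKx.weakTendsto
  have hsum : ⟪xu, kron Λi (zu - xu) + (-(kron Λi (zu - xu)) - kron K.transpose eu)⟫ = 0 := by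
    rw [add_sub, add_neg_cancel, zero_sub, inner_neg_right, ← inner_kron_left, hKxu,
      inner_zero_left, neg_zero]
  have hprod : Tendsto (fun k => ⟪x k, kron Λi (z k - x k) + prodFun B (x k)⟫) (U : Filter ℕ)
      (𝓝 0) := by
    refine Tendsto.mono_left ((tendsto_add_atTop_iff_nat 2).1 ?_) hU
    obtain ⟨Dx, hDx⟩ := h.x_bounded hr hs
    obtain ⟨De, hDe⟩ := h.dualSeq_bounded hr hs
    have h1 := tendsto_inner_zero_of_bounded hDx
      ((tendsto_add_atTop_iff_nat 2).2 (h.tendsto_residual hr hs))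
    have h2 := tendsto_inner_zero_of_bounded (fun k => hDe (k + 1))
      ((tendsto_add_atTop_iff_nat 2).2 (h.tendsto_kron_x hr hs))
    have h3 := h1.sub h2
    rw [sub_zero] at h3
    refine h3.congr fun k => ?_
    rw [inner_add_left _ (kron K.transpose _), real_inner_comm, real_inner_comm (x (k + 2)) (kron _ _),
      inner_kron_left K, add_sub_cancel_right]
  rw [← hsum] at hprod
  obtain ⟨hmem, hB⟩ := demiclosed_pair (A := prodOp A) (B := prodFun B)
    (isMonotone_iff.2 fun p u q w hu hw => by
      rw [PiLp.inner_apply]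
      exact Finset.sum_nonneg fun i _ => (h.maximal i).1.inner_nonneg (hu i) (hw i))
    (fun p u => prodOp_mem_of_inner_nonneg h.maximal) (continuous_prodFun h.lip)
    (fun p q => by
      rw [PiLp.inner_apply]
      exact Finset.sum_nonneg fun i _ => h.inner_B_nonneg i _ _)
    (fun k i => by
      rw [kron_stepMatrix_apply]
      exact hr.resolvent_mem h.α_pos (fun i => (h.maximal i).1) k i)
    hxu hau hbu hprod
  refine ⟨xu, zu, eu, ⟨hKxu, fun i => ?_, fun i => ?_⟩, hxu, hzu, heu⟩
  · have := hmem i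
    rw [hΛi, kron_stepMatrix_apply] at this
    exact this
  · have hi : -((α i)⁻¹ • (zu i - xu i)) - kron K.transpose eu i = B i (xu i) := by
      have := congrArg (fun w : HilbertPower N H => w i) hB
      simpa only [hΛi, PiLp.sub_apply, PiLp.neg_apply, kron_stepMatrix_apply, prodFun] using this
    rw [← hi, sub_add_cancel, smul_neg, smul_inv_smul₀ (h.α_pos i).ne']
    abel

/-- Opial's argument: weak limits of the governing sequence along ultrafilters are unique. -/
theorem governing_limit_unique (h : IsAdmissible A B L α β W K)
    (hr : IsRun A B α β W y0 z0 x y z v) {xs' zs' es' : HilbertPower N H}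
    (hs : IsSaddle A B α K xs zs es) (hs' : IsSaddle A B α K xs' zs' es') {U U' : Ultrafilter ℕ}
    (hU : (U : Filter ℕ) ≤ atTop) (hU' : (U' : Filter ℕ) ≤ atTop)
    (hz : WeakTendsto (U : Filter ℕ) z zs)
    (he : WeakTendsto (U : Filter ℕ) (dualSeq α β K x v) es)
    (hz' : WeakTendsto (U' : Filter ℕ) z zs')
    (he' : WeakTendsto (U' : Filter ℕ) (dualSeq α β K x v) es') : zs = zs' := by
  obtain ⟨c, hc⟩ := h.metricDist_tendsto hr hs
  obtain ⟨c', hc'⟩ := h.metricDist_tendsto hr hs'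
  set Λi := stepMatrix fun i => (α i)⁻¹ with hΛi
  have hΛ : Λi.transpose = Λi := Matrix.diagonal_transpose _
  have hP := dualMetric_transpose (α := α) (β := β) (K := K)
  have hdz := h.tendsto_z_sub hr hs
  have hdz2 : Tendsto (fun k => z (k + 2) - z k) atTop (𝓝 0) := by
    have := ((tendsto_add_atTop_iff_nat 1).2 hdz).add hdz
    rw [add_zero] at this
    exact this.congr fun k => sub_add_sub_cancel _ _ _
  have hde := h.tendsto_dualSeq_sub hr hs
  have key : ∀ (V : Ultrafilter ℕ) (a e : HilbertPower N H), (V : Filter ℕ) ≤ atTop →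
      WeakTendsto (V : Filter ℕ) z a → WeakTendsto (V : Filter ℕ) (dualSeq α β K x v) e →
      (⟪kron Λi (a - zs), a - zs⟫ - ⟪kron Λi (a - zs'), a - zs'⟫)
        + (⟪kron (dualMetric α β K) (e - es), e - es⟫
          - ⟪kron (dualMetric α β K) (e - es'), e - es'⟫) = c - c' := by
    intro V a e hV ha he
    have h1 := tendsto_inner_kron_sub_sub hΛ (ha.congr_sub (hdz2.mono_left hV)) zs zs'
    have h2 := tendsto_inner_kron_sub_sub hP (he.congr_sub (hde.mono_left hV)) es es'
    refine tendsto_nhds_unique (h1.add h2) (((hc.sub hc').mono_left hV).congr fun k => ?_)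
    simp only [metricDist]
    ring
  have k1 := key U zs es hU hz he
  have k2 := key U' zs' es' hU' hz' he'
  have hsq : ∀ (S : Matrix (Fin N) (Fin N) ℝ) (p q : HilbertPower N H),
      ⟪kron S (p - q), p - q⟫ = ⟪kron S (q - p), q - p⟫ := by
    intro S p q
    rw [← neg_sub q p, ← kronL_apply, map_neg, inner_neg_neg, kronL_apply]
  have hzero : ∀ (S : Matrix (Fin N) (Fin N) ℝ) (p : HilbertPower N H),
      ⟪kron S (p - p), p - p⟫ = 0 := fun S p => by rw [sub_self, inner_zero_right]
  rw [hzero, hzero] at k1 k2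
  rw [hsq _ zs' zs, hsq _ es' es] at k2
  have hn := h.dualMetric_nonneg (es - es')
  have hz0 : ⟪kron Λi (zs - zs'), zs - zs'⟫ ≤ 0 := by linarith
  rw [hΛi, inner_kron_stepMatrix] at hz0
  have hnn : ∀ i ∈ Finset.univ, 0 ≤ (α i)⁻¹ * ‖(zs - zs') i‖ ^ 2 := fun i _ =>
    mul_nonneg (inv_pos.2 (h.α_pos i)).le (sq_nonneg _)
  have hall := (Finset.sum_eq_zero_iff_of_nonneg hnn).1 (le_antisymm hz0 (Finset.sum_nonneg hnn))
  ext i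
  have hi := (mul_eq_zero.1 (hall i (Finset.mem_univ i))).resolve_left (inv_pos.2 (h.α_pos i)).ne'
  exact sub_eq_zero.1 (norm_eq_zero.1 (pow_eq_zero_iff two_ne_zero |>.1 hi))

theorem exists_weak_limit [CompleteSpace H] (h : IsAdmissible A B L α β W K)
    (hr : IsRun A B α β W y0 z0 x y z v) (hs : IsSaddle A B α K xs zs es) :
    ∃ xl zl el, IsSaddle A B α K xl zl el ∧ WeaklyConverges z zl ∧ WeaklyConverges x xl ∧
      WeaklyConverges y xl ∧ setResolvent (scaledOp α A) zl = {xl} := by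
  have hmono := fun i => (h.maximal i).1
  obtain ⟨xl, zl, el, hsl, -, hzl, hel⟩ :=
    h.exists_weak_limit_isSaddle hr hs (Ultrafilter.of atTop) (Ultrafilter.of_le _)
  have hres := (setResolvent_scaledOp_eq_singleton_iff h.α_pos hmono).2 hsl.mem
  have key : ∀ U : Ultrafilter ℕ, (U : Filter ℕ) ≤ atTop →
      WeakTendsto (U : Filter ℕ) z zl ∧ WeakTendsto (U : Filter ℕ) x xl := by
    intro U hU
    obtain ⟨xu, zu, eu, hsu, hxu, hzu, heu⟩ := h.exists_weak_limit_isSaddle hr hs U hU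
    obtain rfl : zl = zu :=
      h.governing_limit_unique hr hsl hsu (Ultrafilter.of_le _) hU hzl hel hzu heu
    have hresu := (setResolvent_scaledOp_eq_singleton_iff h.α_pos hmono).2 hsu.mem
    obtain rfl : xl = xu := Set.singleton_injective (hres.symm.trans hresu)
    exact ⟨hzu, hxu⟩
  refine ⟨xl, zl, el, hsl, weaklyConverges_of_ultrafilter fun U hU => (key U hU).1,
    weaklyConverges_of_ultrafilter fun U hU => (key U hU).2,
    weaklyConverges_of_ultrafilter fun U hU => ?_, hres⟩
  refine (key U hU).2.congr_sub ?_
  have := (h.tendsto_x_sub_y hr hs).neg.mono_left hU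
  simpa using this

end IsAdmissible

end Convergence

end DistributedSplitting

theorem mainTheorem1 {H : Type*} [NormedAddCommGroup H] [InnerProductSpace ℝ H] [CompleteSpace H]
    {N : ℕ} (G : SimpleGraph (Fin N)) (hG : G.Connected)
    (W : Matrix (Fin N) (Fin N) ℝ) (hW : DistributedSplitting.IsMixingMatrix G W)
    (A : Fin N → H → Set H) (hA : ∀ i, DistributedSplitting.IsMaximallyMonotone (A i))
    (B : Fin N → H → H)
    (hBmono : ∀ i, DistributedSplitting.IsMonotone (DistributedSplitting.single (B i)))
    (L : Fin N → ℝ≥0) (hBlip : ∀ i, LipschitzWith (L i) (B i))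
    (hsol : (DistributedSplitting.inverse (DistributedSplitting.sumOp A B) 0).Nonempty)
    (α : Fin N → ℝ) (hαpos : ∀ i, 0 < α i)
    -- `α i < 1 / (8 * L i)`, where the bound is `+∞` if `L i = 0`
    (hα : ∀ i, α i * (8 * (L i : ℝ)) < 1)
    (β : ℝ) (hβpos : 0 < β)
    -- `β < ‖Λ^{1/2} ((I - W) / 2) Λ^{1/2}‖⁻¹`, where the bound is `+∞` if the norm is zero
    (hβ : β * DistributedSplitting.matrixSpectralNorm (DistributedSplitting.scaledLaplacian α W) < 1)
    (y0 z0 : DistributedSplitting.HilbertPower N H) :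
    (∃ x y z v : ℕ → DistributedSplitting.HilbertPower N H,
      DistributedSplitting.IsRun A B α β W y0 z0 x y z v) ∧
    ∀ x y z v : ℕ → DistributedSplitting.HilbertPower N H,
      DistributedSplitting.IsRun A B α β W y0 z0 x y z v →
      ∃ zs xs : DistributedSplitting.HilbertPower N H,
        DistributedSplitting.WeaklyConverges z zs ∧
        DistributedSplitting.WeaklyConverges x xs ∧
        DistributedSplitting.WeaklyConverges y xs ∧
        DistributedSplitting.setResolvent (DistributedSplitting.scaledOp α A) zs = {xs} ∧
        ∃ p : H, xs = DistributedSplitting.consensus N p ∧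
          p ∈ DistributedSplitting.inverse (DistributedSplitting.sumOp A B) 0 := by
  have : Nonempty (Fin N) := hG.nonempty
  obtain ⟨K, hK⟩ := hW.exists_factor
  have h : DistributedSplitting.IsAdmissible A B L α β W K :=
    ⟨hA, hBmono, hBlip, hαpos, hα, hβpos, hβ, hK⟩
  refine ⟨DistributedSplitting.exists_isRun hαpos hA B β W y0 z0, fun x y z v hr => ?_⟩
  obtain ⟨xs, zs, es, hs⟩ := DistributedSplitting.exists_isSaddle hsol hαpos hW hK
  obtain ⟨xl, zl, el, hsl, hz, hx, hy, hres⟩ := h.exists_weak_limit hr hs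
  exact ⟨zl, xl, hz, hx, hy, hres, hsl.exists_solution hαpos hW hK⟩
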